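/- Let $A$ and $B$ be (not necessarily unital) $\mathbb Z_2$-graded $C^*$-algebras, i.e. $C^*$-algebras with involutive $*$-automorphisms $\alpha$ of $A$ and $\beta$ of $B$; put $A_{\pm}=\{a\in A:\alpha(a)=\pm a\}$, $B_{\pm}=\{b\in B:\beta(b)=\pm b\}$ and $\varepsilon=\tfrac12(\mathrm{id}+\alpha):A\to A_+$. The algebraic Fermi tensor product $A\,Ⓕ\,B$ is the vector space $A\odot B$ with the product and involution given on homogeneous elements by $(a\,Ⓕ\,b)(a'\,Ⓕ\,b')=\epsilon(b,a')\,aa'\,Ⓕ\,bb'$ and $(a\,Ⓕ\,b)^*=\epsilon(a,b)\,a^*\,Ⓕ\,b^*$, where $\epsilon(x,y)=-1$ if $x$ and $y$ are both odd and $\epsilon(x,y)=1$ otherwise; $A\,Ⓕ_{\max}B$ is its completion in the norm $c\mapsto\sup\{\|\pi(c)\|:\pi\text{ a }*\text{-representation by bounded operators on a Hilbert space}\}$. Likewise $A_+\otimes_{\max}B$ is the completion of the usual $*$-algebra $A_+\odot B$ in its maximal $C^*$-norm. Let $\omega$ be an even state of $A$ (that is, $\omega\circ\alpha=\omega$) and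 $\varphi$ any state of $B$. Then: (a) There is a unique completely positive map $E:A\,Ⓕ_{\max}B\to A_+\otimes_{\max}B$ with $E(a\,Ⓕ\,b)=\varepsilon(a)\otimes b$ for all $a\in A$, $b\in B$. The map $a\otimes b\mapsto a\,Ⓕ\,b$ extends to an isometric $*$-homomorphism of $A_+\otimes_{\max}B$ into $A\,Ⓕ_{\max}B$, and with respect to this inclusion $E$ is a conditional expectation onto $A_+\otimes_{\max}B$. (b) There are a unique state $\psi_{\omega,\varphi}$ of $A_+\otimes_{\max}B$ with $\psi_{\omega,\varphi}(a\otimes b)=\omega(a)\varphi(b)$ for $a\in A_+$, $b\in B$, and a unique state $\omega\times\varphi$ of $A\,Ⓕ_{\max}B$ with $(\omega\times\varphi)(a\,Ⓕ\,b)=\omega(a)\varphi(b)$ for $a\in A$, $b\in B$. (c) $\psi_{\omega,\varphi}$ has a GNS representation. Let $(\mathcal H_0,\pi_0,\xi_0)$ be any GNS representation of $\psi_{\omega,\varphi}$ (i.e. $\xi_0$ is cyclic for the representation $\pi_0$ and $\psi_{\omega,\varphi}(x)=\langle\pi_0(x)\xi_0,\xi_0\rangle$). Then $\pi_0\circ E:A\,Ⓕ_{\max}B\to\mathcal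 B(\mathcal H_0)$ is completely positive and has a minimal Stinespring dilation. Let $(\mathcal H,\pi,V)$ be any Stinespring dilation of it, i.e. $\pi$ is a nondegenerate $*$-representation of $A\,Ⓕ_{\max}B$ on the Hilbert space $\mathcal H$ and $V:\mathcal H_0\to\mathcal H$ is a bounded operator with $\pi_0(E(x))=V^*\pi(x)V$ for all $x$ (for instance the minimal one, for which $\pi(A\,Ⓕ_{\max}B)V\mathcal H_0$ is total in $\mathcal H$). Let $P$ be the orthogonal projection of $\mathcal H$ onto the closure of $\pi(A\,Ⓕ_{\max}B)V\xi_0$. Then $P\in\pi(A\,Ⓕ_{\max}B)'$, $V\xi_0\in P\mathcal H$, and $(P\mathcal H,P\pi,V\xi_0)$ is the GNS representation of $\omega\times\varphi$: $x\mapsto P\pi(x)|_{P\mathcal H}$ is a $*$-representation, $V\xi_0$ is cyclic for it, and $(\omega\times\varphi)(x)=\langle P\pi(x)V\xi_0,V\xi_0\rangle$ for all $x\in A\,Ⓕ_{\max}B$. -/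

import Mathlib

open scoped TensorProduct InnerProductSpace CStarAlgebra ComplexOrder

universe u v w w'

noncomputable section

namespace FermiProduct

/-! ### The completion of a `*`-algebra in its largest representation norm -/

section Enveloping

variable {R : Type u} [NonUnitalRing R] [StarRing R] [Module ℂ R]

/-- The set of all values `‖π c‖`, where `π` is a `*`-representation of the `*`-algebra `R` by
bounded operators on a Hilbert space.  (The norm of a representation is the supremum of the norms
of its cyclic subrepresentations, and their Hilbert spaces fit into the universe of `R`.) -/
def repNorms (c : R) : Set ℝ :=
  {r | ∃ (H : Type u) (_ : NormedAddCommGroup H) (_ : InnerProductSpace ℂ H) (_ : CompleteSpace H)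
    (π : R →⋆ₙₐ[ℂ] (H →L[ℂ] H)), r = ‖π c‖}

/-- The maximal representation norm `sup {‖π c‖ | π a representation}`. -/
def maxNorm (c : R) : ℝ := sSup (repNorms c)

variable (R) in
/-- The supremum that defines the maximal representation norm is finite. -/
class FiniteRepNorms : Prop where
  bddAbove : ∀ c : R, BddAbove (repNorms c)

lemma repNorms_nonempty (c : R) : (repNorms c).Nonempty :=
  ⟨_, PUnit, inferInstance, inferInstance, inferInstance, 0, rfl⟩

lemma maxNorm_le {c : R} {M : ℝ}
    (h : ∀ (H : Type u) [NormedAddCommGroup H] [InnerProductSpace ℂ H] [CompleteSpace H]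
      (π : R →⋆ₙₐ[ℂ] (H →L[ℂ] H)), ‖π c‖ ≤ M) : maxNorm c ≤ M := by
  refine csSup_le (repNorms_nonempty c) ?_
  rintro _ ⟨H, _, _, _, π, rfl⟩
  exact h H π

/-- The `*`-algebra `R`, regarded as a seminormed algebra with the maximal representation norm. -/
def MaxNormed (R : Type u) : Type u := R

section Finite

variable [FiniteRepNorms R]

lemma le_maxNorm (c : R) {H : Type u} [NormedAddCommGroup H] [InnerProductSpace ℂ H]
    [CompleteSpace H] (π : R →⋆ₙₐ[ℂ] (H →L[ℂ] H)) : ‖π c‖ ≤ maxNorm c :=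
  le_csSup (FiniteRepNorms.bddAbove c) ⟨H, _, _, _, π, rfl⟩

lemma maxNorm_nonneg (c : R) : 0 ≤ maxNorm c := by
  simpa using le_maxNorm c (0 : R →⋆ₙₐ[ℂ] (PUnit.{u+1} →L[ℂ] PUnit.{u+1}))

lemma maxNorm_add_le (c d : R) : maxNorm (c + d) ≤ maxNorm c + maxNorm d :=
  maxNorm_le fun H _ _ _ π => by
    rw [map_add]
    exact (norm_add_le _ _).trans (add_le_add (le_maxNorm c π) (le_maxNorm d π))

lemma maxNorm_mul_le (c d : R) : maxNorm (c * d) ≤ maxNorm c * maxNorm d :=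
  maxNorm_le fun H _ _ _ π => by
    rw [map_mul]
    exact (norm_mul_le _ _).trans
      (mul_le_mul (le_maxNorm c π) (le_maxNorm d π) (norm_nonneg _) (maxNorm_nonneg c))

lemma maxNorm_zero : maxNorm (0 : R) = 0 :=
  le_antisymm (maxNorm_le fun H _ _ _ π => by simp) (maxNorm_nonneg 0)

lemma maxNorm_smul_le (z : ℂ) (c : R) : maxNorm (z • c) ≤ ‖z‖ * maxNorm c :=
  maxNorm_le fun H _ _ _ π => by
    rw [map_smul, norm_smul]
    exact mul_le_mul_of_nonneg_left (le_maxNorm c π) (norm_nonneg _)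

lemma maxNorm_neg (c : R) : maxNorm (-c) = maxNorm c := by
  have h : ∀ c : R, maxNorm (-c) ≤ maxNorm c := fun c => maxNorm_le fun H _ _ _ π => by
    rw [map_neg, norm_neg]
    exact le_maxNorm c π
  exact le_antisymm (h c) (by simpa using h (-c))

lemma maxNorm_star (c : R) : maxNorm (star c) = maxNorm c := by
  have h : ∀ c : R, maxNorm (star c) ≤ maxNorm c := fun c => maxNorm_le fun H _ _ _ π => by
    rw [map_star, norm_star]
    exact le_maxNorm c π
  exact le_antisymm (h c) (by simpa using h (star c))

lemma maxNorm_mul_self_le (c : R) : maxNorm c * maxNorm c ≤ maxNorm (star c * c) := by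
  have h : maxNorm c ≤ Real.sqrt (maxNorm (star c * c)) := maxNorm_le fun H _ _ _ π => by
    refine Real.le_sqrt_of_sq_le ?_
    rw [sq, ← CStarRing.norm_star_mul_self, ← map_star, ← map_mul]
    exact le_maxNorm _ π
  calc maxNorm c * maxNorm c
      ≤ Real.sqrt (maxNorm (star c * c)) * Real.sqrt (maxNorm (star c * c)) :=
        mul_self_le_mul_self (maxNorm_nonneg c) h
    _ = _ := Real.mul_self_sqrt (maxNorm_nonneg _)

instance : NonUnitalRing (MaxNormed R) := inferInstanceAs (NonUnitalRing R)

instance : StarRing (MaxNormed R) := inferInstanceAs (StarRing R)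

instance : Module ℂ (MaxNormed R) := inferInstanceAs (Module ℂ R)

instance : NonUnitalSeminormedRing (MaxNormed R) where
  __ : NonUnitalRing (MaxNormed R) := inferInstance
  __ := AddGroupSeminorm.toSeminormedAddCommGroup (E := MaxNormed R)
    { toFun := maxNorm (R := R)
      map_zero' := maxNorm_zero (R := R)
      add_le' := maxNorm_add_le (R := R)
      neg' := maxNorm_neg (R := R) }
  norm_mul_le := maxNorm_mul_le (R := R)

instance : NormedStarGroup (MaxNormed R) where
  norm_star_le c := (maxNorm_star (R := R) c).le

instance : NormedSpace ℂ (MaxNormed R) where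
  __ : Module ℂ (MaxNormed R) := inferInstance
  norm_smul_le := maxNorm_smul_le (R := R)

variable (R) in
/-- The completion of the `*`-algebra `R` with respect to its maximal representation norm. -/
def MaxCompletion : Type u := UniformSpace.Completion (MaxNormed R)

namespace MaxCompletion

open UniformSpace

instance : NormedAddCommGroup (MaxCompletion R) :=
  inferInstanceAs (NormedAddCommGroup (Completion (MaxNormed R)))

instance : NormedSpace ℂ (MaxCompletion R) :=
  inferInstanceAs (NormedSpace ℂ (Completion (MaxNormed R)))

instance : CompleteSpace (MaxCompletion R) :=
  inferInstanceAs (CompleteSpace (Completion (MaxNormed R)))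

/-- The canonical map of a `*`-algebra into its completion, as a linear map. -/
def ofₗ : R →ₗ[ℂ] MaxCompletion R where
  toFun c := ((show MaxNormed R from c : MaxNormed R) : Completion (MaxNormed R))
  map_add' c d := Completion.coe_add (α := MaxNormed R) c d
  map_smul' z c := Completion.coe_smul (X := MaxNormed R) z c

lemma norm_ofₗ (c : R) : ‖(ofₗ c : MaxCompletion R)‖ = maxNorm c :=
  Completion.norm_coe (E := MaxNormed R) c

lemma isDenseInducing_ofₗ : IsDenseInducing (fun c : MaxNormed R => (ofₗ (R := R) c)) :=
  Completion.isDenseInducing_coe (α := MaxNormed R)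

lemma denseRange_ofₗ : DenseRange (ofₗ : R → MaxCompletion R) :=
  isDenseInducing_ofₗ.dense

lemma continuous_ofₗ : Continuous (fun c : MaxNormed R => (ofₗ (R := R) c)) :=
  isDenseInducing_ofₗ.continuous

/-- The product of the completion, the continuous extension of the product of `R`. -/
instance : Mul (MaxCompletion R) :=
  ⟨fun x y => (isDenseInducing_ofₗ.prodMap isDenseInducing_ofₗ).extend
    (fun p : MaxNormed R × MaxNormed R => ofₗ (R := R) (p.1 * p.2)) (x, y)⟩

lemma ofₗ_mul (c d : R) : (ofₗ (c * d) : MaxCompletion R) = ofₗ c * ofₗ d :=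
  ((isDenseInducing_ofₗ.prodMap isDenseInducing_ofₗ).extend_eq
    (f := fun p : MaxNormed R × MaxNormed R => ofₗ (R := R) (p.1 * p.2))
      (continuous_ofₗ.comp (continuous_mul (M := MaxNormed R))) (c, d)).symm

instance : ContinuousMul (MaxCompletion R) where
  continuous_mul := by
    let o : MaxNormed R →+ MaxCompletion R := (ofₗ (R := R)).toAddMonoidHom
    let m : MaxNormed R →+ MaxNormed R →+ MaxCompletion R :=
      (AddMonoidHom.mul : MaxNormed R →+ MaxNormed R →+ MaxNormed R).compr₂ o
    have : Continuous fun p : MaxNormed R × MaxNormed R => m p.1 p.2 :=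
      continuous_ofₗ.comp continuous_mul
    have di : IsDenseInducing o := isDenseInducing_ofₗ
    exact (di.extend_Z_bilin di this :)

/-- The involution of the completion, the continuous extension of the involution of `R`. -/
instance : Star (MaxCompletion R) := ⟨Completion.map (star : MaxNormed R → MaxNormed R)⟩

lemma uniformContinuous_star : UniformContinuous (star : MaxNormed R → MaxNormed R) :=
  (starNormedAddGroupHom (E := MaxNormed R)).uniformContinuous

lemma ofₗ_star (c : R) : (ofₗ (star c) : MaxCompletion R) = star (ofₗ c) :=
  (Completion.map_coe uniformContinuous_star (show MaxNormed R from c)).symm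

instance : ContinuousStar (MaxCompletion R) where
  continuous_star := Completion.continuous_map (f := (star : MaxNormed R → MaxNormed R))

@[elab_as_elim]
lemma induction₁ {p : MaxCompletion R → Prop} (x : MaxCompletion R)
    (hp : IsClosed {x | p x}) (ih : ∀ c : R, p (ofₗ c)) : p x :=
  Completion.induction_on (α := MaxNormed R) x hp ih

@[elab_as_elim]
lemma induction₂ {p : MaxCompletion R → MaxCompletion R → Prop} (x y : MaxCompletion R)
    (hp : IsClosed {x : MaxCompletion R × MaxCompletion R | p x.1 x.2})
    (ih : ∀ c d : R, p (ofₗ c) (ofₗ d)) : p x y :=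
  Completion.induction_on₂ (α := MaxNormed R) (β := MaxNormed R) x y hp ih

@[elab_as_elim]
lemma induction₃ {p : MaxCompletion R → MaxCompletion R → MaxCompletion R → Prop}
    (x y z : MaxCompletion R)
    (hp : IsClosed
      {x : MaxCompletion R × MaxCompletion R × MaxCompletion R | p x.1 x.2.1 x.2.2})
    (ih : ∀ c d e : R, p (ofₗ c) (ofₗ d) (ofₗ e)) : p x y z :=
  Completion.induction_on₃ (α := MaxNormed R) (β := MaxNormed R) (γ := MaxNormed R) x y z hp ih

instance : NonUnitalRing (MaxCompletion R) where
  __ : AddCommGroup (MaxCompletion R) := inferInstance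
  zero_mul x := by
    induction x using induction₁ with
    | hp => exact isClosed_eq (by fun_prop) (by fun_prop)
    | ih c =>
      rw [← map_zero (ofₗ (R := R)), ← ofₗ_mul, zero_mul]
  mul_zero x := by
    induction x using induction₁ with
    | hp => exact isClosed_eq (by fun_prop) (by fun_prop)
    | ih c =>
      rw [← map_zero (ofₗ (R := R)), ← ofₗ_mul, mul_zero]
  mul_assoc x y z := by
    induction x, y, z using induction₃ with
    | hp => exact isClosed_eq (by fun_prop) (by fun_prop)
    | ih c d e =>
      simp only [← ofₗ_mul, mul_assoc]
  left_distrib x y z := by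
    induction x, y, z using induction₃ with
    | hp => exact isClosed_eq (by fun_prop) (by fun_prop)
    | ih c d e =>
      simp only [← ofₗ_mul, ← map_add, mul_add]
  right_distrib x y z := by
    induction x, y, z using induction₃ with
    | hp => exact isClosed_eq (by fun_prop) (by fun_prop)
    | ih c d e =>
      simp only [← ofₗ_mul, ← map_add, add_mul]

instance : NonUnitalNormedRing (MaxCompletion R) where
  __ : NonUnitalRing (MaxCompletion R) := inferInstance
  __ : NormedAddCommGroup (MaxCompletion R) := inferInstance
  norm_mul_le x y := by
    induction x, y using induction₂ with
    | hp => exact isClosed_le (by fun_prop) (by fun_prop)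
    | ih c d =>
      simpa only [← ofₗ_mul, norm_ofₗ] using maxNorm_mul_le c d

instance : StarRing (MaxCompletion R) where
  star_involutive x := by
    induction x using induction₁ with
    | hp => exact isClosed_eq (by fun_prop) (by fun_prop)
    | ih c =>
      simp only [← ofₗ_star, star_star]
  star_mul x y := by
    induction x, y using induction₂ with
    | hp => exact isClosed_eq (by fun_prop) (by fun_prop)
    | ih c d =>
      simp only [← ofₗ_star, ← ofₗ_mul, star_mul]
  star_add x y := by
    induction x, y using induction₂ with
    | hp => exact isClosed_eq (by fun_prop) (by fun_prop)
    | ih c d =>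
      simp only [← ofₗ_star, ← map_add, star_add]

instance : CStarRing (MaxCompletion R) where
  norm_mul_self_le x := by
    induction x using induction₁ with
    | hp => exact isClosed_le (by fun_prop) (by fun_prop)
    | ih c =>
      simpa only [← ofₗ_star, ← ofₗ_mul, norm_ofₗ] using maxNorm_mul_self_le c

variable [IsScalarTower ℂ R R] [SMulCommClass ℂ R R] [StarModule ℂ R]

instance : IsScalarTower ℂ (MaxCompletion R) (MaxCompletion R) where
  smul_assoc z x y := by
    change z • x * y = z • (x * y)
    induction x, y using induction₂ with
    | hp =>
      exact isClosed_eq ((continuous_fst.const_smul z).mul continuous_snd)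
          ((continuous_fst.mul continuous_snd).const_smul z)
    | ih c d => rw [← map_smul, ← ofₗ_mul, ← ofₗ_mul, ← map_smul, smul_mul_assoc]

instance : SMulCommClass ℂ (MaxCompletion R) (MaxCompletion R) where
  smul_comm z x y := by
    change z • (x * y) = x * z • y
    induction x, y using induction₂ with
    | hp =>
      exact isClosed_eq ((continuous_fst.mul continuous_snd).const_smul z)
          (continuous_fst.mul (continuous_snd.const_smul z))
    | ih c d => rw [← map_smul, ← ofₗ_mul, ← ofₗ_mul, ← map_smul, mul_smul_comm]

instance : StarModule ℂ (MaxCompletion R) where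
  star_smul z x := by
    induction x using induction₁ with
    | hp =>
      exact isClosed_eq (continuous_star.comp (continuous_const_smul z))
          (continuous_star.const_smul (star z))
    | ih c => rw [← map_smul, ← ofₗ_star, ← ofₗ_star, ← map_smul, star_smul]

/-- The completion is a C⋆-algebra. -/
instance : NonUnitalCStarAlgebra (MaxCompletion R) where

/-- A C⋆-algebra is ordered by its positive cone, the set of all `x⋆ x`. -/
instance : PartialOrder (MaxCompletion R) := CStarAlgebra.spectralOrder _

instance : StarOrderedRing (MaxCompletion R) := CStarAlgebra.spectralOrderedRing _

variable (R) in
/-- The canonical `*`-homomorphism of a `*`-algebra into its completion. -/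
def of : R →⋆ₙₐ[ℂ] MaxCompletion R where
  toFun := ofₗ
  map_smul' z c := map_smul ofₗ z c
  map_zero' := map_zero ofₗ
  map_add' := map_add ofₗ
  map_mul' := ofₗ_mul
  map_star' := ofₗ_star

end MaxCompletion
end Finite
end Enveloping
/-! ### Finiteness of the representation norms of tensor products -/

section Bound

variable {A B D : Type*} [NonUnitalCStarAlgebra A] [NonUnitalCStarAlgebra B]
  [NonUnitalCStarAlgebra D]

/-- A bilinear map that is multiplicative and involutive is bounded in the first variable. -/
lemma exists_bound_left (m : A →ₗ[ℂ] B →ₗ[ℂ] D)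
    (hmul : ∀ a a' b b', m a b * m a' b' = m (a * a') (b * b'))
    (hstar : ∀ a b, star (m a b) = m (star a) (star b)) (b : B) :
    ∃ C : ℝ, ∀ a, ‖m a b‖ ≤ C * ‖a‖ := by
  let _ : PartialOrder A := CStarAlgebra.spectralOrder A
  let _ : StarOrderedRing A := CStarAlgebra.spectralOrderedRing A
  let _ : PartialOrder B := CStarAlgebra.spectralOrder B
  let _ : StarOrderedRing B := CStarAlgebra.spectralOrderedRing B
  let _ : PartialOrder D := CStarAlgebra.spectralOrder D
  let _ : StarOrderedRing D := CStarAlgebra.spectralOrderedRing D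
  have hpos : ∀ k : B, 0 ≤ k → ∃ C : ℝ, ∀ a, ‖m a k‖ ≤ C * ‖a‖ := by
    intro k hk
    obtain ⟨y, rfl⟩ := CStarAlgebra.nonneg_iff_eq_star_mul_self.mp hk
    let f : A →ₚ[ℂ] D := PositiveLinearMap.mk₀ (m.flip (star y * y)) (by
      intro a ha
      obtain ⟨x, rfl⟩ := CStarAlgebra.nonneg_iff_eq_star_mul_self.mp ha
      rw [LinearMap.flip_apply, ← hmul, ← hstar]
      exact star_mul_self_nonneg _)
    obtain ⟨C, hC⟩ := PositiveLinearMap.exists_norm_apply_le f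
    exact ⟨C, hC⟩
  obtain ⟨k, hk, -, hb⟩ := CStarAlgebra.exists_sum_four_nonneg b
  choose C hC using fun i => hpos (k i) (hk i)
  refine ⟨∑ i, C i, fun a => ?_⟩
  rw [hb, map_sum, Finset.sum_mul]
  refine norm_sum_le_of_le _ fun i _ => ?_
  rw [map_smul, norm_smul]
  simpa using hC i a

/-- A bilinear map that is multiplicative and involutive is contractive. -/
lemma norm_bilin_le (m : A →ₗ[ℂ] B →ₗ[ℂ] D)
    (hmul : ∀ a a' b b', m a b * m a' b' = m (a * a') (b * b'))
    (hstar : ∀ a b, star (m a b) = m (star a) (star b)) (a : A) (b : B) :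
    ‖m a b‖ ≤ ‖a‖ * ‖b‖ := by
  have hl := exists_bound_left m hmul hstar
  have hr := exists_bound_left m.flip (fun b b' a a' => hmul a a' b b') (fun b a => hstar a b)
  have hC : ∃ C : ℝ, ∀ a b, ‖m a b‖ ≤ C * (‖a‖ * ‖b‖) := by
    choose Cr hCr using hr
    obtain ⟨C, hC⟩ := banach_steinhaus
      (g := fun a : {a : A // ‖a‖ ≤ 1} => (m a.1).mkContinuous (Cr a.1) (hCr a.1)) (by
        intro b
        obtain ⟨C, hC⟩ := hl b
        refine ⟨|C|, fun a => ?_⟩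
        calc ‖m a.1 b‖ ≤ C * ‖a.1‖ := hC a.1
          _ ≤ |C| * 1 := mul_le_mul (le_abs_self C) a.2 (norm_nonneg _) (abs_nonneg C)
          _ = |C| := mul_one _)
    refine ⟨C, fun a b => ?_⟩
    by_cases ha : a = 0
    · simp [ha]
    have hn : 0 < ‖a‖ := norm_pos_iff.mpr ha
    have h1 : ‖((‖a‖⁻¹ : ℝ) : ℂ) • a‖ ≤ 1 := by
      rw [norm_smul]
      simp [inv_mul_cancel₀ hn.ne']
    have h2 := ContinuousLinearMap.le_of_opNorm_le _ (hC ⟨_, h1⟩) b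
    have h3 : ‖m (((‖a‖⁻¹ : ℝ) : ℂ) • a) b‖ ≤ C * ‖b‖ := h2
    rw [map_smul, LinearMap.smul_apply, norm_smul] at h3
    simp only [Complex.norm_real, norm_inv, norm_norm] at h3
    calc ‖m a b‖ = ‖a‖ * (‖a‖⁻¹ * ‖m a b‖) := by field_simp
      _ ≤ ‖a‖ * (C * ‖b‖) := mul_le_mul_of_nonneg_left h3 hn.le
      _ = C * (‖a‖ * ‖b‖) := by ring
  obtain ⟨C, hC⟩ := hC
  have hpow : ∀ n : ℕ, ∀ a b, IsSelfAdjoint a → IsSelfAdjoint b →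
      ‖m a b‖ ^ (2 ^ n) ≤ C * (‖a‖ * ‖b‖) ^ (2 ^ n) := by
    intro n
    induction n with
    | zero => intro a b _ _; simpa using hC a b
    | succ n ih =>
      intro a b ha hb
      have e1 : ‖m (a * a) (b * b)‖ = ‖m a b‖ ^ 2 := by
        rw [← hmul]
        rw [sq, ← CStarRing.norm_star_mul_self, hstar, ha.star_eq, hb.star_eq]
      have := ih (a * a) (b * b) (by rw [IsSelfAdjoint, star_mul, ha.star_eq])
        (by rw [IsSelfAdjoint, star_mul, hb.star_eq])
      have e2 : ‖a * a‖ = ‖a‖ ^ 2 := by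
        rw [sq, ← CStarRing.norm_star_mul_self, ha.star_eq]
      have e3 : ‖b * b‖ = ‖b‖ ^ 2 := by
        rw [sq, ← CStarRing.norm_star_mul_self, hb.star_eq]
      rw [e1, e2, e3, ← mul_pow, ← pow_mul, ← pow_mul] at this
      rw [pow_succ, mul_comm (2 ^ n) 2]
      exact this
  have hsa : ∀ a b, IsSelfAdjoint a → IsSelfAdjoint b → ‖m a b‖ ≤ ‖a‖ * ‖b‖ := by
    intro a b ha hb
    by_contra! hlt
    have hp := fun n => hpow n a b ha hb
    have hx : 0 < ‖m a b‖ := lt_of_le_of_lt (by positivity) hlt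
    rcases (mul_nonneg (norm_nonneg a) (norm_nonneg b)).eq_or_lt with h0 | h0
    · have := hp 0
      rw [← h0] at this
      simp only [pow_zero, pow_one, mul_zero] at this
      exact absurd this (not_le.mpr hx)
    · obtain ⟨n, hn⟩ := pow_unbounded_of_one_lt C ((one_lt_div h0).mpr hlt)
      have h1 : (‖m a b‖ / (‖a‖ * ‖b‖)) ^ (2 ^ n) ≤ C := by
        rw [div_pow, div_le_iff₀ (by positivity)]
        exact hp n
      have h2 : (‖m a b‖ / (‖a‖ * ‖b‖)) ^ n ≤ (‖m a b‖ / (‖a‖ * ‖b‖)) ^ (2 ^ n) :=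
        pow_le_pow_right₀ ((one_lt_div h0).mpr hlt).le Nat.lt_two_pow_self.le
      exact absurd (hn.trans_le (h2.trans h1)) (lt_irrefl _)
  have h := hsa (star a * a) (star b * b) (.star_mul_self a) (.star_mul_self b)
  rw [← hmul, ← hstar, CStarRing.norm_star_mul_self, CStarRing.norm_star_mul_self,
    CStarRing.norm_star_mul_self] at h
  have h' : ‖m a b‖ * ‖m a b‖ ≤ (‖a‖ * ‖b‖) * (‖a‖ * ‖b‖) := by linarith
  exact nonneg_le_nonneg_of_sq_le_sq (by positivity) h'

end Bound

section Tensor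

variable (A : Type u) (B : Type v) [NonUnitalCStarAlgebra A] [NonUnitalCStarAlgebra B]

instance : FiniteRepNorms (A ⊗[ℂ] B) where
  bddAbove c := by
    suffices h : ∃ C : ℝ, ∀ r ∈ repNorms c, r ≤ C from h
    induction c using TensorProduct.induction_on with
    | zero => exact ⟨0, by rintro _ ⟨H, _, _, _, π, rfl⟩; simp⟩
    | add x y hx hy =>
      obtain ⟨C, hC⟩ := hx
      obtain ⟨C', hC'⟩ := hy
      refine ⟨C + C', ?_⟩
      rintro _ ⟨H, _, _, _, π, rfl⟩
      rw [map_add]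
      exact (norm_add_le _ _).trans
        (add_le_add (hC _ ⟨H, _, _, _, π, rfl⟩) (hC' _ ⟨H, _, _, _, π, rfl⟩))
    | tmul a b =>
      refine ⟨‖a‖ * ‖b‖, ?_⟩
      rintro _ ⟨H, _, _, _, π, rfl⟩
      exact norm_bilin_le ((TensorProduct.mk ℂ A B).compr₂ (π : A ⊗[ℂ] B →ₗ[ℂ] (H →L[ℂ] H)))
        (fun a a' b b' => by
          change π _ * π _ = π _
          rw [← map_mul, TensorProduct.mk_apply, TensorProduct.mk_apply, TensorProduct.mk_apply,
            Algebra.TensorProduct.tmul_mul_tmul])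
        (fun a b => by
          change star (π _) = π _
          rw [← map_star, TensorProduct.mk_apply, TensorProduct.mk_apply,
            TensorProduct.star_tmul]) a b

/-- The maximal C⋆-tensor product `A ⊗_max B`: the completion of the algebraic tensor product (with
its usual product and involution) in the maximal C⋆-norm. -/
abbrev MaxTensor : Type (max u v) := MaxCompletion (A ⊗[ℂ] B)

end Tensor

/-! ### `ℤ₂`-gradings and the algebraic Fermi tensor product -/

/-- A `ℤ₂`-grading of a C⋆-algebra, given by an involutive `*`-automorphism `θ`. -/
structure Z2Grading (A : Type u) [NonUnitalCStarAlgebra A] where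
  /-- the grading automorphism -/
  auto : A ≃⋆ₐ[ℂ] A
  involutive : ∀ a, auto (auto a) = a

namespace Z2Grading

variable {A : Type u} [NonUnitalCStarAlgebra A] (θ : Z2Grading A)

/-- The projection `(id + i θ) / 2` onto the homogeneous component of degree `i = ±1`. -/
def proj (i : ℤˣ) : A →ₗ[ℂ] A :=
  (1 / 2 : ℂ) • (LinearMap.id + ((i : ℤ) : ℂ) • (θ.auto : A →ₗ[ℂ] A))

lemma proj_apply (i : ℤˣ) (a : A) :
    θ.proj i a = (1 / 2 : ℂ) • (a + ((i : ℤ) : ℂ) • θ.auto a) := rfl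

lemma proj_one_add_proj_neg_one (a : A) : θ.proj 1 a + θ.proj (-1) a = a := by
  simp only [proj_apply, Units.val_one, Units.val_neg, Int.cast_one, Int.cast_neg]
  module

lemma proj_one_sub_proj_neg_one (a : A) : θ.proj 1 a - θ.proj (-1) a = θ.auto a := by
  simp only [proj_apply, Units.val_one, Units.val_neg, Int.cast_one, Int.cast_neg]
  module

lemma auto_proj (i : ℤˣ) (a : A) : θ.auto (θ.proj i a) = ((i : ℤ) : ℂ) • θ.proj i a := by
  rcases Int.units_eq_one_or i with rfl | rfl <;>
  · simp only [proj_apply, map_smul, map_add, θ.involutive, Units.val_one, Units.val_neg,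
      Int.cast_one, Int.cast_neg]
    module

lemma proj_eq_of_auto {i : ℤˣ} {a : A} (h : θ.auto a = ((i : ℤ) : ℂ) • a) :
    θ.proj i a = a := by
  rw [proj_apply, h]
  rcases Int.units_eq_one_or i with rfl | rfl <;>
  · simp only [Units.val_one, Units.val_neg, Int.cast_one, Int.cast_neg]
    module

lemma proj_neg_eq_zero_of_auto {i : ℤˣ} {a : A} (h : θ.auto a = ((i : ℤ) : ℂ) • a) :
    θ.proj (-i) a = 0 := by
  rw [proj_apply, h]
  rcases Int.units_eq_one_or i with rfl | rfl <;>
  · simp only [Units.val_one, Units.val_neg, Int.cast_one, Int.cast_neg]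
    module

lemma proj_proj_mul (i j : ℤˣ) (a b : A) :
    θ.proj i (θ.proj j a * b) = θ.proj j a * θ.proj (i * j) b := by
  rw [proj_apply, map_mul, auto_proj, proj_apply θ (i * j) b]
  simp only [mul_add, smul_mul_assoc, mul_smul_comm, smul_smul, Units.val_mul, Int.cast_mul]

lemma proj_one_proj_one (a : A) : θ.proj 1 (θ.proj 1 a) = θ.proj 1 a :=
  θ.proj_eq_of_auto (θ.auto_proj 1 a)

lemma proj_neg_one_proj_neg_one (a : A) : θ.proj (-1) (θ.proj (-1) a) = θ.proj (-1) a :=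
  θ.proj_eq_of_auto (θ.auto_proj (-1) a)

lemma proj_neg_one_proj_one (a : A) : θ.proj (-1) (θ.proj 1 a) = 0 :=
  θ.proj_neg_eq_zero_of_auto (θ.auto_proj 1 a)

lemma proj_one_proj_neg_one (a : A) : θ.proj 1 (θ.proj (-1) a) = 0 := by
  simpa using θ.proj_neg_eq_zero_of_auto (θ.auto_proj (-1) a)

lemma proj_star (i : ℤˣ) (a : A) : θ.proj i (star a) = star (θ.proj i a) := by
  simp [proj_apply, map_star]

lemma auto_star_mul_self {i : ℤˣ} {a : A} (h : θ.auto a = ((i : ℤ) : ℂ) • a) :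
    θ.auto (star a * a) = star a * a := by
  rw [map_mul, map_star, h]
  rcases Int.units_eq_one_or i with rfl | rfl <;> simp

/-- The even part `A₊ = {a | θ a = a}`, a C⋆-subalgebra. -/
def evenPart : NonUnitalStarSubalgebra ℂ A where
  carrier := {a | θ.auto a = a}
  add_mem' {a b} ha hb := by
    change θ.auto (a + b) = a + b
    rw [map_add, show θ.auto a = a from ha, show θ.auto b = b from hb]
  zero_mem' := map_zero _
  mul_mem' {a b} ha hb := by
    change θ.auto (a * b) = a * b
    rw [map_mul, show θ.auto a = a from ha, show θ.auto b = b from hb]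
  smul_mem' z a ha := by
    change θ.auto (z • a) = z • a
    rw [map_smul, show θ.auto a = a from ha]
  star_mem' {a} ha := by
    change θ.auto (star a) = star a
    rw [map_star, show θ.auto a = a from ha]

lemma mem_evenPart {a : A} : a ∈ θ.evenPart ↔ θ.auto a = a := Iff.rfl

lemma continuous_auto : Continuous θ.auto :=
  (NonUnitalStarAlgHom.isometry θ.auto (EquivLike.injective θ.auto)).continuous

instance : IsClosed (θ.evenPart : Set A) :=
  isClosed_eq θ.continuous_auto continuous_id

/-- The conditional expectation `ε = (id + θ) / 2` of `A` onto `A₊`. -/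
def evenExpectation : A →ₗ[ℂ] θ.evenPart where
  toFun a := ⟨θ.proj 1 a, by rw [mem_evenPart, auto_proj]; simp⟩
  map_add' a b := Subtype.ext (map_add _ a b)
  map_smul' z a := Subtype.ext (map_smul _ z a)

end Z2Grading

section Fermi

variable {A : Type u} {B : Type v} [NonUnitalCStarAlgebra A] [NonUnitalCStarAlgebra B]

/-- The sign `ε(i, j)`: it is `-1` if `i = j = -1`, and `1` otherwise. -/
def gradeSign (i j : ℤˣ) : ℂ := if i = -1 ∧ j = -1 then -1 else 1

/-- The algebraic Fermi tensor product of two `ℤ₂`-graded C⋆-algebras.  Its linear space is the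
algebraic tensor product; product and involution are twisted by the gradings, see
`FermiTensor.mul_def` and `FermiTensor.star_def`. -/
def FermiTensor (_ : Z2Grading A) (_ : Z2Grading B) : Type (max u v) := A ⊗[ℂ] B

namespace FermiTensor

variable (α : Z2Grading A) (β : Z2Grading B)

instance : AddCommGroup (FermiTensor α β) := inferInstanceAs (AddCommGroup (A ⊗[ℂ] B))
instance : Module ℂ (FermiTensor α β) := inferInstanceAs (Module ℂ (A ⊗[ℂ] B))

/-- The identification of linear spaces of `A ⊗ B` with the Fermi tensor product. -/
def ofTensor : (A ⊗[ℂ] B) ≃ₗ[ℂ] FermiTensor α β := LinearEquiv.refl ℂ (A ⊗[ℂ] B)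

/-- The elementary tensor `a Ⓕ b`. -/
def tmul (a : A) (b : B) : FermiTensor α β := ofTensor α β (a ⊗ₜ[ℂ] b)

/-- The component `x_{i,j}` of `x` in `A_i ⊙ B_j`. -/
def component (i j : ℤˣ) : FermiTensor α β →ₗ[ℂ] A ⊗[ℂ] B :=
  TensorProduct.map (α.proj i) (β.proj j) ∘ₗ (ofTensor α β).symm.toLinearMap

/-- The product `x y = ∑ ε(j, k) x_{i,j} · y_{k,l}`, where `·` is the usual product of `A ⊗ B`. -/
instance : Mul (FermiTensor α β) where
  mul x y := ofTensor α β (∑ i : ℤˣ, ∑ j : ℤˣ, ∑ k : ℤˣ, ∑ l : ℤˣ,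
    gradeSign j k • (component α β i j x * component α β k l y))

/-- The involution `x⋆ = ∑ ε(i, j) x_{i,j}^†`, where `†` is the usual involution of `A ⊗ B`. -/
instance : Star (FermiTensor α β) where
  star x := ofTensor α β (∑ i : ℤˣ, ∑ j : ℤˣ, gradeSign i j • star (component α β i j x))

variable {α β}

lemma mul_def (x y : FermiTensor α β) :
    x * y = ofTensor α β (∑ i : ℤˣ, ∑ j : ℤˣ, ∑ k : ℤˣ, ∑ l : ℤˣ,
      gradeSign j k • (component α β i j x * component α β k l y)) := rfl

lemma star_def (x : FermiTensor α β) :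
    star x = ofTensor α β (∑ i : ℤˣ, ∑ j : ℤˣ, gradeSign i j • star (component α β i j x)) := rfl

lemma component_tmul (i j : ℤˣ) (a : A) (b : B) :
    component α β i j (tmul α β a b) = α.proj i a ⊗ₜ[ℂ] β.proj j b := rfl

@[elab_as_elim]
lemma induction_on {p : FermiTensor α β → Prop} (x : FermiTensor α β) (zero : p 0)
    (tmul : ∀ a b, p (tmul α β a b)) (add : ∀ x y, p x → p y → p (x + y)) : p x :=
  TensorProduct.induction_on x zero tmul add

lemma tmul_add (a : A) (b b' : B) : tmul α β a (b + b') = tmul α β a b + tmul α β a b' := by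
  simp [tmul, TensorProduct.tmul_add]

lemma add_tmul (a a' : A) (b : B) : tmul α β (a + a') b = tmul α β a b + tmul α β a' b := by
  simp [tmul, TensorProduct.add_tmul]

lemma smul_tmul (z : ℂ) (a : A) (b : B) : tmul α β (z • a) b = z • tmul α β a b := by
  rw [tmul, ← TensorProduct.smul_tmul', map_smul]; rfl

lemma tmul_smul (z : ℂ) (a : A) (b : B) : tmul α β a (z • b) = z • tmul α β a b := by
  rw [tmul, TensorProduct.tmul_smul, map_smul]; rfl

lemma sum_units {M : Type*} [AddCommMonoid M] (f : ℤˣ → M) : ∑ i, f i = f 1 + f (-1) := by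
  rw [show (Finset.univ : Finset ℤˣ) = {1, -1} from by decide,
    Finset.sum_pair (by decide)]

lemma tmul_mul_tmul (a a' : A) (b b' : B) :
    tmul α β a b * tmul α β a' b' =
      tmul α β (a * a') (β.proj 1 b * b') + tmul α β (a * α.auto a') (β.proj (-1) b * b') := by
  have h1 : gradeSign 1 1 = 1 := by simp [gradeSign]
  have h2 : gradeSign 1 (-1) = 1 := by simp [gradeSign]
  have h3 : gradeSign (-1) 1 = 1 := by simp [gradeSign]
  have h4 : gradeSign (-1) (-1) = -1 := by simp [gradeSign]
  rw [mul_def]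
  simp only [component_tmul, Algebra.TensorProduct.tmul_mul_tmul, sum_units, h1, h2, h3, h4]
  have ha := α.proj_one_add_proj_neg_one a
  have ha' := α.proj_one_add_proj_neg_one a'
  have hb' := β.proj_one_add_proj_neg_one b'
  rw [← α.proj_one_sub_proj_neg_one a']
  generalize α.proj 1 a = a₁ at *
  generalize α.proj (-1) a = a₂ at *
  generalize α.proj 1 a' = a₃ at *
  generalize α.proj (-1) a' = a₄ at *
  generalize β.proj 1 b' = b₃ at *
  generalize β.proj (-1) b' = b₄ at *
  subst ha ha' hb'
  simp only [tmul, ← map_add]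
  congr 1
  simp only [mul_add, mul_sub, add_mul, TensorProduct.add_tmul, TensorProduct.tmul_add,
    TensorProduct.sub_tmul]
  module

lemma star_tmul (a : A) (b : B) :
    star (tmul α β a b) =
      tmul α β (star a) (star (β.proj 1 b)) +
        tmul α β (star (α.auto a)) (star (β.proj (-1) b)) := by
  have h1 : gradeSign 1 1 = 1 := by simp [gradeSign]
  have h2 : gradeSign 1 (-1) = 1 := by simp [gradeSign]
  have h3 : gradeSign (-1) 1 = 1 := by simp [gradeSign]
  have h4 : gradeSign (-1) (-1) = -1 := by simp [gradeSign]
  rw [star_def]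
  simp only [component_tmul, TensorProduct.star_tmul, sum_units, h1, h2, h3, h4]
  have ha := α.proj_one_add_proj_neg_one a
  rw [← α.proj_one_sub_proj_neg_one a]
  generalize α.proj 1 a = a₁ at *
  generalize α.proj (-1) a = a₂ at *
  subst ha
  simp only [tmul, ← map_add]
  congr 1
  simp only [star_add, star_sub, TensorProduct.add_tmul, TensorProduct.sub_tmul]
  module

lemma add_mul' (x y z : FermiTensor α β) : (x + y) * z = x * z + y * z := by
  simp only [mul_def, map_add, add_mul, smul_add, Finset.sum_add_distrib]

lemma mul_add' (x y z : FermiTensor α β) : x * (y + z) = x * y + x * z := by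
  simp only [mul_def, map_add, mul_add, smul_add, Finset.sum_add_distrib]

lemma zero_mul' (x : FermiTensor α β) : 0 * x = 0 := by
  simp [mul_def]

lemma mul_zero' (x : FermiTensor α β) : x * 0 = 0 := by
  simp [mul_def]

lemma smul_mul' (z : ℂ) (x y : FermiTensor α β) : (z • x) * y = z • (x * y) := by
  simp only [mul_def, map_smul, smul_mul_assoc, Finset.smul_sum, map_sum, smul_comm z]

lemma mul_smul' (z : ℂ) (x y : FermiTensor α β) : x * (z • y) = z • (x * y) := by
  simp only [mul_def, map_smul, mul_smul_comm, Finset.smul_sum, map_sum, smul_comm z]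

lemma star_add' (x y : FermiTensor α β) : star (x + y) = star x + star y := by
  simp only [star_def, map_add, star_add, smul_add, Finset.sum_add_distrib]

lemma star_zero' : star (0 : FermiTensor α β) = 0 := by
  simp [star_def]

lemma star_smul' (z : ℂ) (x : FermiTensor α β) : star (z • x) = star z • star x := by
  simp only [star_def, map_smul, star_smul, Finset.smul_sum, map_sum, smul_comm (star z)]

lemma mul_assoc' (x y z : FermiTensor α β) : x * y * z = x * (y * z) := by
  induction x using induction_on with
  | zero => simp only [zero_mul']
  | add x x' hx hx' => simp only [add_mul', hx, hx']
  | tmul a b =>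
    induction y using induction_on with
    | zero => simp only [zero_mul', mul_zero']
    | add y y' hy hy' => simp only [add_mul', mul_add', hy, hy']
    | tmul a' b' =>
      induction z using induction_on with
      | zero => simp only [mul_zero']
      | add z z' hz hz' => simp only [mul_add', hz, hz']
      | tmul a'' b'' =>
        simp only [tmul_mul_tmul, add_mul', mul_add', Z2Grading.proj_proj_mul, one_mul, mul_one,
          neg_mul_neg, map_mul, α.involutive, mul_assoc]
        abel

lemma star_star' (x : FermiTensor α β) : star (star x) = x := by
  induction x using induction_on with
  | zero => simp only [star_zero']
  | add x x' hx hx' => simp only [star_add', hx, hx']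
  | tmul a b =>
    have h0 : ∀ a : A, tmul α β a 0 = 0 := fun a => by simp [tmul]
    simp only [star_tmul, star_add', Z2Grading.proj_star, Z2Grading.proj_one_proj_one,
      Z2Grading.proj_neg_one_proj_neg_one, Z2Grading.proj_neg_one_proj_one,
      Z2Grading.proj_one_proj_neg_one, star_zero, star_star, h0, map_star, α.involutive,
      add_zero, zero_add, ← tmul_add, β.proj_one_add_proj_neg_one]

lemma star_mul' (x y : FermiTensor α β) : star (x * y) = star y * star x := by
  induction x using induction_on with
  | zero => simp only [zero_mul', mul_zero', star_zero']
  | add x x' hx hx' => simp only [add_mul', mul_add', star_add', hx, hx']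
  | tmul a b =>
    induction y using induction_on with
    | zero => simp only [zero_mul', mul_zero', star_zero']
    | add y y' hy hy' => simp only [add_mul', mul_add', star_add', hy, hy']
    | tmul a' b' =>
      have h0 : ∀ a : A, tmul α β a 0 = 0 := fun a => by simp [tmul]
      simp only [star_tmul, star_add', tmul_mul_tmul, add_mul', mul_add', Z2Grading.proj_star,
        Z2Grading.proj_proj_mul, Z2Grading.proj_one_proj_one,
        Z2Grading.proj_neg_one_proj_neg_one, Z2Grading.proj_neg_one_proj_one,
        Z2Grading.proj_one_proj_neg_one, star_zero, star_mul, h0, map_star, map_mul, α.involutive,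
        add_zero, zero_add, zero_mul, one_mul, mul_one, neg_mul_neg]
      abel

instance : NonUnitalRing (FermiTensor α β) where
  left_distrib := mul_add'
  right_distrib := add_mul'
  zero_mul := zero_mul'
  mul_zero := mul_zero'
  mul_assoc := mul_assoc'

instance : StarRing (FermiTensor α β) where
  star_involutive := star_star'
  star_mul := star_mul'
  star_add := star_add'

instance : StarModule ℂ (FermiTensor α β) := ⟨star_smul'⟩
instance : IsScalarTower ℂ (FermiTensor α β) (FermiTensor α β) := ⟨smul_mul'⟩
instance : SMulCommClass ℂ (FermiTensor α β) (FermiTensor α β) :=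
  ⟨fun z x y => (mul_smul' z x y).symm⟩

lemma norm_rep_tmul_le {D : Type*} [NonUnitalCStarAlgebra D] (π : FermiTensor α β →⋆ₙₐ[ℂ] D)
    {i j : ℤˣ} {a : A} {b : B} (ha : α.auto a = ((i : ℤ) : ℂ) • a)
    (hb : β.auto b = ((j : ℤ) : ℂ) • b) : ‖π (tmul α β a b)‖ ≤ ‖a‖ * ‖b‖ := by
  have heven : ∀ (a : α.evenPart) (b : β.evenPart),
      ‖π (tmul α β (a : A) (b : B))‖ ≤ ‖a‖ * ‖b‖ := by
    have h0 : ∀ a : A, tmul α β a 0 = 0 := fun a => by simp [tmul]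
    have h1 : ∀ b : β.evenPart, β.proj 1 (b : B) = b := fun b =>
      β.proj_eq_of_auto (by simpa using β.mem_evenPart.mp b.2)
    have h2 : ∀ b : β.evenPart, β.proj (-1) (b : B) = 0 := fun b =>
      β.proj_neg_eq_zero_of_auto (by simpa using β.mem_evenPart.mp b.2)
    refine norm_bilin_le (LinearMap.mk₂ ℂ
      (fun (a : α.evenPart) (b : β.evenPart) => π (tmul α β (a : A) (b : B)))
      (fun a a' b => ?_) (fun z a b => ?_) (fun a b b' => ?_) (fun z a b => ?_))
      (fun a a' b b' => ?_) (fun a b => ?_)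
    · simp [add_tmul]
    · simp [smul_tmul]
    · simp [tmul_add]
    · simp [tmul_smul]
    · simp only [LinearMap.mk₂_apply]
      rw [← map_mul, tmul_mul_tmul, h1, h2, zero_mul, h0, add_zero]
      rfl
    · simp only [LinearMap.mk₂_apply]
      rw [← map_star, star_tmul, h1, h2, star_zero, h0, add_zero]
      rfl
  have key : star (tmul α β a b) * tmul α β a b = tmul α β (star a * a) (star b * b) := by
    have h0 : ∀ a : A, tmul α β a 0 = 0 := fun a => by simp [tmul]
    have hb1 := β.proj_eq_of_auto hb
    have hb2 := β.proj_neg_eq_zero_of_auto hb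
    rcases Int.units_eq_one_or j with rfl | rfl
    · rw [star_tmul, hb1, hb2, star_zero, h0, add_zero, tmul_mul_tmul, β.proj_star, hb1,
        β.proj_star, hb2, star_zero, zero_mul, h0, add_zero]
    · rw [neg_neg] at hb2
      rw [star_tmul, hb1, hb2, star_zero, h0, zero_add, tmul_mul_tmul, β.proj_star, hb2,
        β.proj_star, hb1, star_zero, zero_mul, h0, zero_add, ← map_star, ← map_mul,
        α.auto_star_mul_self ha]
  have h := heven ⟨star a * a, α.auto_star_mul_self ha⟩ ⟨star b * b, β.auto_star_mul_self hb⟩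
  have h' : ‖π (tmul α β (star a * a) (star b * b))‖ ≤ ‖star a * a‖ * ‖star b * b‖ := h
  rw [← key, map_mul, map_star, CStarRing.norm_star_mul_self, CStarRing.norm_star_mul_self,
    CStarRing.norm_star_mul_self] at h'
  exact nonneg_le_nonneg_of_sq_le_sq (by positivity) (by linarith)

instance : FiniteRepNorms (FermiTensor α β) where
  bddAbove c := by
    suffices h : ∃ C : ℝ, ∀ r ∈ repNorms c, r ≤ C from h
    induction c using induction_on with
    | zero => exact ⟨0, by rintro _ ⟨H, _, _, _, π, rfl⟩; simp⟩
    | add x y hx hy =>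
      obtain ⟨C, hC⟩ := hx
      obtain ⟨C', hC'⟩ := hy
      refine ⟨C + C', ?_⟩
      rintro _ ⟨H, _, _, _, π, rfl⟩
      rw [map_add]
      exact (norm_add_le _ _).trans
        (add_le_add (hC _ ⟨H, _, _, _, π, rfl⟩) (hC' _ ⟨H, _, _, _, π, rfl⟩))
    | tmul a b =>
      refine ⟨∑ i : ℤˣ, ∑ j : ℤˣ, ‖α.proj i a‖ * ‖β.proj j b‖, ?_⟩
      rintro _ ⟨H, _, _, _, π, rfl⟩
      have h : tmul α β a b = ∑ i : ℤˣ, ∑ j : ℤˣ, tmul α β (α.proj i a) (β.proj j b) := by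
        simp only [sum_units, ← tmul_add, ← add_tmul, Z2Grading.proj_one_add_proj_neg_one]
      rw [h, map_sum]
      refine norm_sum_le_of_le _ fun i _ => ?_
      rw [map_sum]
      exact norm_sum_le_of_le _ fun j _ =>
        norm_rep_tmul_le π (α.auto_proj i a) (β.auto_proj j b)

end FermiTensor

/-- The Fermi C⋆-tensor product `A Ⓕ_max B`: the completion of the algebraic Fermi tensor product in
the maximal C⋆-norm. -/
abbrev FermiMax (α : Z2Grading A) (β : Z2Grading B) : Type (max u v) :=
  MaxCompletion (FermiTensor α β)

end Fermi

/-! ### States, GNS representations, Stinespring dilations, conditional expectations -/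

section Representations

/-- A state of a C⋆-algebra: a positive linear functional of norm one. -/
def IsState {C : Type*} [NonUnitalCStarAlgebra C] (f : C →L[ℂ] ℂ) : Prop :=
  (∀ x, 0 ≤ f (star x * x)) ∧ ‖f‖ = 1

variable {C : Type*} [NonUnitalCStarAlgebra C] {H K : Type*}
  [NormedAddCommGroup H] [InnerProductSpace ℂ H] [CompleteSpace H]
  [NormedAddCommGroup K] [InnerProductSpace ℂ K] [CompleteSpace K]

/-- `(H, π, ξ)` is the GNS representation of `f` (which is determined up to unitary equivalence):
`ξ` is a cyclic vector of the representation `π`, and `f` is the vector functional of `ξ`. -/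
structure IsGNS (f : C →L[ℂ] ℂ) (π : C →⋆ₙₐ[ℂ] (H →L[ℂ] H)) (ξ : H) : Prop where
  cyclic : Dense (Set.range fun x => π x ξ)
  apply_eq : ∀ x, f x = ⟪ξ, π x ξ⟫_ℂ

/-- The closed cyclic subspace generated by `ξ`, the closure of `π(C) ξ`. -/
def cyclicSubspace (π : C →⋆ₙₐ[ℂ] (H →L[ℂ] H)) (ξ : H) : Submodule ℂ H :=
  (Submodule.span ℂ (Set.range fun x => π x ξ)).topologicalClosure

instance (π : C →⋆ₙₐ[ℂ] (H →L[ℂ] H)) (ξ : H) : CompleteSpace (cyclicSubspace π ξ) :=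
  Submodule.topologicalClosure.completeSpace _

variable [PartialOrder C] [StarOrderedRing C]

/-- `(H, π, V)` is a Stinespring dilation of the completely positive map `Φ : C → 𝓑(K)`: `π` is a
nondegenerate representation of `C` on `H` and `V : K → H` is bounded with `Φ x = V⋆ π(x) V`. -/
structure IsStinespringDilation (Φ : C →CP (K →L[ℂ] K)) (π : C →⋆ₙₐ[ℂ] (H →L[ℂ] H))
    (V : K →L[ℂ] H) : Prop where
  nondegenerate : Dense (Submodule.span ℂ {h : H | ∃ x h', h = π x h'} : Set H)
  apply_eq : ∀ x, Φ x = V.adjoint ∘L π x ∘L V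

/-- A Stinespring dilation `(H, π, V)` is minimal if `π(C) V K` is total in `H`. -/
def IsMinimalDilation (π : C →⋆ₙₐ[ℂ] (H →L[ℂ] H)) (V : K →L[ℂ] H) : Prop :=
  Dense (Submodule.span ℂ {h : H | ∃ x k, h = π x (V k)} : Set H)

/-- The completely positive map `E : C → D` is a conditional expectation of `C` onto its
C⋆-subalgebra `D`, where `j : D → C` is the inclusion. -/
structure IsConditionalExpectation {D : Type*} [NonUnitalCStarAlgebra D] [PartialOrder D]
    [StarOrderedRing D] (j : D →⋆ₙₐ[ℂ] C) (E : C →CP D) : Prop where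
  isometry : Isometry j
  projection : ∀ y, E (j y) = y
  mul_right : ∀ x y, E (x * j y) = E x * y
  mul_left : ∀ x y, E (j y * x) = y * E x

end Representations

section Product

variable {A : Type u} {B : Type v} [NonUnitalCStarAlgebra A] [NonUnitalCStarAlgebra B]
  (α : Z2Grading A) (β : Z2Grading B)

/-- The elementary tensor `a Ⓕ b` in the Fermi C⋆-tensor product. -/
def fermiTmul (a : A) (b : B) : FermiMax α β :=
  MaxCompletion.of (FermiTensor α β) (FermiTensor.tmul α β a b)

/-- The elementary tensor `a ⊗ b` in the maximal C⋆-tensor product. -/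
def maxTmul (a : A) (b : B) : MaxTensor A B :=
  MaxCompletion.of (A ⊗[ℂ] B) (a ⊗ₜ[ℂ] b)

/-- The map `E : A Ⓕ_max B → A₊ ⊗_max B` satisfies `E (a Ⓕ b) = ε(a) ⊗ b`. -/
def IsEvenExpectation (E : FermiMax α β →CP MaxTensor α.evenPart B) : Prop :=
  ∀ a b, E (fermiTmul α β a b) = maxTmul (α.evenExpectation a) b

/-- `ψ` is the product state of (the restriction of) `ω` and `φ` on `A₊ ⊗_max B`. -/
def IsEvenProductState (ω : A →L[ℂ] ℂ) (φ : B →L[ℂ] ℂ)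
    (ψ : MaxTensor α.evenPart B →L[ℂ] ℂ) : Prop :=
  IsState ψ ∧ ∀ (a : α.evenPart) b, ψ (maxTmul a b) = ω a * φ b

/-- `χ` is the product state `ω × φ` on `A Ⓕ_max B`. -/
def IsFermiProductState (ω : A →L[ℂ] ℂ) (φ : B →L[ℂ] ℂ) (χ : FermiMax α β →L[ℂ] ℂ) : Prop :=
  IsState χ ∧ ∀ a b, χ (fermiTmul α β a b) = ω a * φ b

end Product

end FermiProduct

end

open FermiProduct

noncomputable section

namespace FermiProduct

/-! ### Representations on completions of pre-Hilbert spaces -/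

section PreHilbert

open UniformSpace

/-! The algebraic core is that `ε ⊗ id` maps each `x⋆ x` of the Fermi product to a finite sum of
squares in `A₊ ⊙ B`. For `x = ∑ a_k Ⓕ b_k` the Fermi signs cancel and leave `∑ ε(a_k⋆ a_l) ⊗ b_k⋆
b_l` (`evenMap_star_tmul_mul_tmul`). The matrix of the `ε(a_k⋆ a_l)` is positive and fixed by `α`
entrywise; positive square roots are unique, so its root is fixed too and has entries in `A₊`
(`exists_evenExpectation_gram`, `exists_evenMap_star_mul_self`).

Vector functionals of representations of `A₊ ⊙ B` therefore pull back to positive functionals on the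
algebraic Fermi product, and the GNS construction applies to them (`exists_gns_rep`). The operators
it produces are bounded because iterated Cauchy-Schwarz along `r⋆ r`, `(r⋆ r)²`, `(r⋆ r)⁴`, ...
controls `r` by the growth of its moments (`norm_sq_le_of_squares`); for `r = a Ⓕ b` with `a`
homogeneous these elements stay elementary tensors with even left leg. Comparing norms in the
resulting representations shows that the maximal norm of the Fermi product restricts to that of `A₊
⊙ B` (`maxNorm_incl`), so the inclusion `j` is isometric. With `θ` the extension of `a Ⓕ b ↦ α(a) Ⓕ
b`, the expectation is determined by `j ∘ E = (id + θ) / 2`; it is completely positive because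
injective `*`-homomorphisms reflect positivity, also for matrices.

The product functional on `A₊ ⊙ B` is positive by the Schur product theorem and contractive by GNS
vectors coming from approximate units (`norm_productFunctional_le`). Since `ω = ω ∘ ε`, the product
state on the Fermi product is `ψ ∘ E`. Finally `⟨V ξ₀, π(x) V ξ₀⟩ = ⟨ξ₀, π₀(E x) ξ₀⟩ = ψ(E x)`, and
nondegeneracy puts `V ξ₀` into the cyclic subspace it generates, so every Stinespring dilation
contains the GNS representation of `ω × φ`. -/

lemma le_of_pow_two_pow_le {a b C : ℝ} (hb : 0 ≤ b)
    (h : ∀ n : ℕ, a ^ 2 ^ n ≤ C * b ^ 2 ^ n) : a ≤ b := by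
  by_contra! hlt
  rcases hb.eq_or_lt with h0 | h0
  · have := h 0
    rw [← h0] at this hlt
    simp only [pow_zero, pow_one, mul_zero] at this
    exact absurd this (not_le.mpr hlt)
  · obtain ⟨n, hn⟩ := pow_unbounded_of_one_lt C ((one_lt_div h0).mpr hlt)
    have h1 : (a / b) ^ 2 ^ n ≤ C := by
      rw [div_pow, div_le_iff₀ (by positivity)]
      exact h n
    have h2 : (a / b) ^ n ≤ (a / b) ^ 2 ^ n :=
      pow_le_pow_right₀ ((one_lt_div h0).mpr hlt).le Nat.lt_two_pow_self.le
    exact absurd (hn.trans_le (h2.trans h1)) (lt_irrefl _)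

/-- Supplies the sequences along which `norm_sq_le_of_squares` measures growth. Repeated squaring
can be carried out separately in the two legs of an elementary tensor. -/
lemma exists_squares {D : Type*} [NonUnitalCStarAlgebra D] (d : D) :
    ∃ q : ℕ → D, q 0 = d ∧ (∀ n, q (n + 1) = q n * q n) ∧ ∀ n, ‖q n‖ ≤ ‖d‖ ^ 2 ^ n := by
  let q : ℕ → D := fun n => Nat.rec d (fun _ p => p * p) n
  refine ⟨q, rfl, fun n => rfl, fun n => ?_⟩
  induction n with
  | zero => simp [q]
  | succ n ih =>
    calc ‖q n * q n‖ ≤ ‖q n‖ * ‖q n‖ := norm_mul_le _ _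
      _ ≤ ‖d‖ ^ 2 ^ n * ‖d‖ ^ 2 ^ n := by gcongr
      _ = _ := by rw [pow_succ 2 n, pow_mul, sq]

variable {R : Type*} [NonUnitalRing R] [StarRing R] [Module ℂ R]
  {X : Type*} [SeminormedAddCommGroup X] [InnerProductSpace ℂ X]

/-- An action of a `*`-algebra on a pre-Hilbert space by bounded adjointable operators extends to a
representation on the completion. -/
theorem exists_rep_completion (L : R →ₗ[ℂ] X →ₗ[ℂ] X)
    (hmul : ∀ r s x, L (r * s) x = L r (L s x))
    (hadj : ∀ r x y, ⟪L r x, y⟫_ℂ = ⟪x, L (star r) y⟫_ℂ)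
    (hbdd : ∀ r, ∃ M : ℝ, ∀ x, ‖L r x‖ ≤ M * ‖x‖) :
    ∃ π : R →⋆ₙₐ[ℂ] (Completion X →L[ℂ] Completion X),
      ∀ r (x : X), π r (x : Completion X) = (L r x : Completion X) := by
  choose M hM using hbdd
  let T : R → X →L[ℂ] X := fun r => (L r).mkContinuous (M r) (hM r)
  have hT : ∀ r x, T r x = L r x := fun _ _ => rfl
  have hext : ∀ f g : Completion X →L[ℂ] Completion X,
      (∀ x : X, f x = g x) → f = g := fun f g h => by
    ext x
    induction x using Completion.induction_on with
    | hp => exact isClosed_eq f.continuous g.continuous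
    | ih x => exact h x
  refine ⟨{ toFun := fun r => (T r).completion
            map_smul' := fun z r => hext _ _ fun x => ?_
            map_zero' := hext _ _ fun x => ?_
            map_add' := fun r s => hext _ _ fun x => ?_
            map_mul' := fun r s => hext _ _ fun x => ?_
            map_star' := fun r => ?_ }, fun r x => ?_⟩
  · simp [hT, Completion.coe_smul]
  · simp [hT, Completion.coe_zero]
  · simp [hT, Completion.coe_add]
  · simp [hT, hmul]
  · refine (ContinuousLinearMap.eq_adjoint_iff _ _).mpr fun x y => ?_
    induction x, y using Completion.induction_on₂ with
    | hp => apply isClosed_eq <;> fun_prop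
    | ih x y => simp [hT, hadj]
  · change (T r).completion x = _
    simp [hT]

/-- If the moments of `r⋆ r` along iterated squares grow at most geometrically with ratio `M`, then
`r` acts as an operator of norm at most `√M`. -/
theorem norm_sq_le_of_squares (L : R →ₗ[ℂ] X →ₗ[ℂ] X)
    (hmul : ∀ r s x, L (r * s) x = L r (L s x))
    (hadj : ∀ r x y, ⟪L r x, y⟫_ℂ = ⟪x, L (star r) y⟫_ℂ)
    (r : R) (q : ℕ → R) (hq₀ : q 0 = star r * r) (hq : ∀ n, q (n + 1) = q n * q n)
    {M : ℝ} (hM : 0 ≤ M) (x : X) {C : ℝ}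
    (hC : ∀ n, ‖⟪x, L (q n) x⟫_ℂ‖ ≤ C * M ^ 2 ^ n) : ‖L r x‖ ^ 2 ≤ M * ‖x‖ ^ 2 := by
  have hsa : ∀ n, star (q n) = q n := fun n => by
    induction n with
    | zero => rw [hq₀, star_mul, star_star]
    | succ n ih => rw [hq, star_mul, ih]
  have h0 : ‖⟪x, L (q 0) x⟫_ℂ‖ = ‖L r x‖ ^ 2 := by
    rw [hq₀, hmul, ← hadj, inner_self_eq_norm_sq_to_K]
    simp
  -- Cauchy-Schwarz together with `q (n + 1) = (q n)⋆ (q n)`, as `q n` is self-adjoint.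
  have hs : ∀ n, ‖⟪x, L (q n) x⟫_ℂ‖ ^ 2 ≤ ‖x‖ ^ 2 * ‖⟪x, L (q (n + 1)) x⟫_ℂ‖ := fun n => by
    have h1 : ‖⟪x, L (q (n + 1)) x⟫_ℂ‖ = ‖L (q n) x‖ ^ 2 := by
      conv_lhs => rw [hq, hmul, ← hsa n, ← hadj, hsa n, inner_self_eq_norm_sq_to_K]
      simp
    rw [h1, ← mul_pow]
    exact pow_le_pow_left₀ (norm_nonneg _) (norm_inner_le_norm _ _) 2
  -- The form may be degenerate. For `‖x‖ = 0` the inequality just proved already gives `‖L r x‖ =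
  -- 0`, and afterwards one may divide by `‖x‖²`.
  rcases (sq_nonneg ‖x‖).eq_or_lt with ht | ht
  · have := hs 0
    rw [← ht, zero_mul, h0] at this
    rw [← ht, mul_zero]
    exact (pow_eq_zero_iff two_ne_zero).mp (le_antisymm this (sq_nonneg _)) |>.le
  set t := ‖x‖ ^ 2
  -- This is `m₀ ^ 2ⁿ ≤ t ^ (2ⁿ - 1) * mₙ` for the moments `mₙ`, multiplied by `t` to avoid
  -- subtraction in the exponent.
  have hind : ∀ n : ℕ, ‖⟪x, L (q 0) x⟫_ℂ‖ ^ 2 ^ n * t ≤ t ^ 2 ^ n * ‖⟪x, L (q n) x⟫_ℂ‖ := by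
    intro n
    induction n with
    | zero => simp [mul_comm]
    | succ n ih =>
      refine le_of_mul_le_mul_right ?_ ht
      calc ‖⟪x, L (q 0) x⟫_ℂ‖ ^ 2 ^ (n + 1) * t * t
          = (‖⟪x, L (q 0) x⟫_ℂ‖ ^ 2 ^ n * t) ^ 2 := by rw [pow_succ 2 n, pow_mul]; ring
        _ ≤ (t ^ 2 ^ n * ‖⟪x, L (q n) x⟫_ℂ‖) ^ 2 :=
            pow_le_pow_left₀ (by positivity) ih 2
        _ = t ^ 2 ^ (n + 1) * ‖⟪x, L (q n) x⟫_ℂ‖ ^ 2 := by rw [pow_succ 2 n, pow_mul]; ring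
        _ ≤ t ^ 2 ^ (n + 1) * (t * ‖⟪x, L (q (n + 1)) x⟫_ℂ‖) := by gcongr; exact hs n
        _ = _ := by ring
  rw [← h0]
  -- The constant `C / t` disappears on taking `2ⁿ`-th roots.
  refine le_of_pow_two_pow_le (C := C / t) (by positivity) fun n => ?_
  rw [div_mul_eq_mul_div, le_div_iff₀ ht, mul_pow]
  calc _ ≤ t ^ 2 ^ n * ‖⟪x, L (q n) x⟫_ℂ‖ := hind n
    _ ≤ t ^ 2 ^ n * (C * M ^ 2 ^ n) := by gcongr; exact hC n
    _ = _ := by ring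

/-- A positive semidefinite form on a module over a `*`-algebra, for which the algebra acts by
adjointable operators with a spanning set of geometrically bounded elements, induces a
representation on a Hilbert space. -/
theorem exists_rep_of_form {R : Type u} [NonUnitalRing R] [StarRing R] [Module ℂ R]
    {X : Type v} [AddCommGroup X] [Module ℂ X]
    (B : X →ₗ⋆[ℂ] X →ₗ[ℂ] ℂ) (hsymm : ∀ x y, star (B y x) = B x y)
    (hpos : ∀ x, 0 ≤ (B x x).re) (L : R →ₗ[ℂ] X →ₗ[ℂ] X)
    (hmul : ∀ r s x, L (r * s) x = L r (L s x))
    (hadj : ∀ r x y, B (L r x) y = B x (L (star r) y))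
    (G : Set R) (hG : Submodule.span ℂ G = ⊤)
    (hgrow : ∀ r ∈ G, ∃ (q : ℕ → R) (M : ℝ), q 0 = star r * r ∧ (∀ n, q (n + 1) = q n * q n) ∧
      0 ≤ M ∧ ∀ x, ∃ C : ℝ, ∀ n, ‖B x (L (q n) x)‖ ≤ C * M ^ 2 ^ n) :
    ∃ (H : Type v) (_ : NormedAddCommGroup H) (_ : InnerProductSpace ℂ H) (_ : CompleteSpace H)
      (ι : X →ₗ[ℂ] H) (π : R →⋆ₙₐ[ℂ] (H →L[ℂ] H)), DenseRange ι ∧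
      (∀ x y, ⟪ι x, ι y⟫_ℂ = B x y) ∧ ∀ r x, π r (ι x) = ι (L r x) := by
  -- No quotient by the null space is formed: `X` becomes a seminormed space, and its Hausdorff
  -- completion identifies vectors at distance zero.
  let core : PreInnerProductSpace.Core ℂ X :=
    { inner := fun x y => B x y
      conj_inner_symm := fun x y => hsymm x y
      re_inner_nonneg := hpos
      add_left := fun x y z => by simp
      smul_left := fun x y z => by simp }
  let _ : SeminormedAddCommGroup X :=
    InnerProductSpace.Core.toSeminormedAddCommGroup (c := core)
  let _ : InnerProductSpace ℂ X := InnerProductSpace.ofCore core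
  have hB : ∀ x y : X, ⟪x, y⟫_ℂ = B x y := fun _ _ => rfl
  have hadj' : ∀ r x y, ⟪L r x, y⟫_ℂ = ⟪x, L (star r) y⟫_ℂ := hadj
  -- Elements acting boundedly form a subspace, so it suffices to bound the spanning set `G`.
  have hbdd : ∀ r, ∃ M : ℝ, ∀ x, ‖L r x‖ ≤ M * ‖x‖ := by
    intro r
    have hr : r ∈ Submodule.span ℂ G := hG ▸ Submodule.mem_top
    induction hr using Submodule.span_induction with
    | mem r hr =>
      obtain ⟨q, M, hq₀, hq, hM, hC⟩ := hgrow r hr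
      refine ⟨√M, fun x => ?_⟩
      obtain ⟨C, hC⟩ := hC x
      have := norm_sq_le_of_squares L hmul hadj' r q hq₀ hq hM x hC
      refine le_of_sq_le_sq ?_ (by positivity)
      rwa [mul_pow, Real.sq_sqrt hM]
    | zero => exact ⟨0, fun x => by simp⟩
    | add r s _ _ hr hs =>
      obtain ⟨M, hM⟩ := hr
      obtain ⟨N, hN⟩ := hs
      refine ⟨M + N, fun x => ?_⟩
      rw [map_add, LinearMap.add_apply, add_mul]
      exact (norm_add_le _ _).trans (add_le_add (hM x) (hN x))
    | smul z r _ hr =>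
      obtain ⟨M, hM⟩ := hr
      refine ⟨‖z‖ * M, fun x => ?_⟩
      rw [map_smul, LinearMap.smul_apply, norm_smul, mul_assoc]
      exact mul_le_mul_of_nonneg_left (hM x) (norm_nonneg _)
  obtain ⟨π, hπ⟩ := exists_rep_completion L hmul hadj' hbdd
  refine ⟨Completion X, inferInstance, inferInstance, inferInstance,
    (Completion.toComplL (𝕜 := ℂ) (E := X)).toLinearMap, π, Completion.denseRange_coe,
    fun x y => ?_, fun r x => hπ r x⟩
  exact (Completion.inner_coe x y).trans (hB x y)

end PreHilbert

/-! ### Stinespring dilations and GNS representations -/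

section Stinespring

open Filter Topology

variable {C : Type u} [NonUnitalCStarAlgebra C] {K : Type w} [NormedAddCommGroup K]
  [InnerProductSpace ℂ K]

/-- The sesquilinear form `⟨c ⊗ k, d ⊗ l⟩ = ⟨k, Φ(c⋆ d) l⟩` on `C ⊗ K`. -/
def stinespringForm (Φ : C →ₗ[ℂ] (K →L[ℂ] K)) : C ⊗[ℂ] K →ₗ⋆[ℂ] C ⊗[ℂ] K →ₗ[ℂ] ℂ :=
  TensorProduct.lift (LinearMap.mk₂'ₛₗ (starRingEnd ℂ) (starRingEnd ℂ)
    (fun c k => TensorProduct.lift (LinearMap.mk₂ ℂ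
      (fun d l => ⟪k, Φ (star c * d) l⟫_ℂ)
      (fun d d' l => by simp [mul_add])
      (fun z d l => by simp [mul_smul_comm])
      (fun d l l' => by simp)
      (fun z d l => by simp)))
    (fun c c' k => TensorProduct.ext' fun d l => by simp [add_mul])
    (fun z c k => TensorProduct.ext' fun d l => by simp [smul_mul_assoc])
    (fun c k k' => TensorProduct.ext' fun d l => by simp)
    (fun z c k => TensorProduct.ext' fun d l => by simp [mul_comm]))

/-- Left multiplication of `C` on `C ⊗ K`. -/
def stinespringAction (C : Type u) [NonUnitalCStarAlgebra C] (K : Type w) [NormedAddCommGroup K]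
    [InnerProductSpace ℂ K] : C →ₗ[ℂ] C ⊗[ℂ] K →ₗ[ℂ] C ⊗[ℂ] K :=
  (LinearMap.rTensorHom K) ∘ₗ (LinearMap.mul ℂ C)

lemma stinespringAction_tmul (c d : C) (k : K) :
    stinespringAction C K c (d ⊗ₜ k) = (c * d) ⊗ₜ k := rfl

lemma exists_eq_star_mul_self {D : Type*} [NonUnitalCStarAlgebra D] [PartialOrder D]
    [StarOrderedRing D] {x : D} (hx : 0 ≤ x) : ∃ y, x = star y * y :=
  CStarAlgebra.nonneg_iff_eq_star_mul_self.mp hx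

lemma half_smul_nonneg {D : Type*} [NonUnitalCStarAlgebra D] [PartialOrder D]
    [StarOrderedRing D] {x : D} (hx : 0 ≤ x) : 0 ≤ (1 / 2 : ℂ) • x := by
  obtain ⟨y, rfl⟩ := exists_eq_star_mul_self hx
  obtain ⟨h, hh⟩ : ∃ h : ℂ, star h * h = 1 / 2 := ⟨(√(1 / 2) : ℝ), by
    rw [Complex.star_def, Complex.conj_ofReal, ← Complex.ofReal_mul,
      Real.mul_self_sqrt (by norm_num)]
    norm_num⟩
  rw [← hh, ← smul_mul_smul_comm, ← star_smul]
  exact star_mul_self_nonneg _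

lemma exists_eq_sum_star_mul_of_nonneg {D : Type*} [NonUnitalCStarAlgebra D] [PartialOrder D]
    [StarOrderedRing D] {n : Type*} [Fintype n] {M : CStarMatrix n n D} (hM : 0 ≤ M) :
    ∃ Y : CStarMatrix n n D, ∀ i j, M i j = ∑ m, star (Y m i) * Y m j := by
  obtain ⟨Y, hY⟩ := exists_eq_star_mul_self hM
  refine ⟨Y, fun i j => ?_⟩
  rw [hY, CStarMatrix.mul_apply]
  rfl

/-- The matrix is `N⋆ N` for the square matrix `N` with first row `c` and all other rows zero. Size
zero has no first row and is treated apart. -/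
lemma gram_nonneg {D : Type*} [NonUnitalCStarAlgebra D] [PartialOrder D]
    [StarOrderedRing D] {n : ℕ} (c : Fin n → D) :
    0 ≤ CStarMatrix.ofMatrix (fun i j => star (c i) * c j) := by
  rcases n with _ | n
  · exact le_of_eq (CStarMatrix.ext fun i => i.elim0)
  let N : CStarMatrix (Fin (n + 1)) (Fin (n + 1)) D :=
    CStarMatrix.ofMatrix fun i j => if i = 0 then c j else 0
  have hN : ∀ i j, N i j = if i = 0 then c j else 0 := fun _ _ => rfl
  have : star N * N = CStarMatrix.ofMatrix (fun i j => star (c i) * c j) := by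
    refine CStarMatrix.ext fun i j => ?_
    rw [CStarMatrix.mul_apply, Fin.sum_univ_succ]
    simp only [CStarMatrix.star_apply, hN, if_pos, Fin.succ_ne_zero, if_false, mul_zero,
      Finset.sum_const_zero, add_zero]
    rfl
  rw [← this]
  exact star_mul_self_nonneg N

lemma IsState.apply_star {f : C →L[ℂ] ℂ} (hf : IsState f) (x : C) : f (star x) = star (f x) := by
  let _ : PartialOrder C := CStarAlgebra.spectralOrder C
  let _ : StarOrderedRing C := CStarAlgebra.spectralOrderedRing C
  let g : C →ₚ[ℂ] ℂ := PositiveLinearMap.mk₀ (f : C →ₗ[ℂ] ℂ) (by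
    intro a ha
    obtain ⟨x, rfl⟩ := CStarAlgebra.nonneg_iff_eq_star_mul_self.mp ha
    exact hf.1 x)
  exact map_star g x

lemma IsMinimalDilation.nondegenerate [PartialOrder C] [StarOrderedRing C]
    {H : Type*} [NormedAddCommGroup H] [InnerProductSpace ℂ H]
    [CompleteSpace H] {π : C →⋆ₙₐ[ℂ] (H →L[ℂ] H)} {V : K →L[ℂ] H} (h : IsMinimalDilation π V) :
    Dense (Submodule.span ℂ {h : H | ∃ x h', h = π x h'} : Set H) := by
  refine h.mono (Submodule.span_mono ?_)
  rintro _ ⟨x, k, rfl⟩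
  exact ⟨x, V k, rfl⟩

variable [CompleteSpace K] [PartialOrder C] [StarOrderedRing C]

/-- Stinespring's theorem for a bounded map that is completely positive in the sense that its
kernel `(c, d) ↦ Φ(c⋆ d)` is positive definite. -/
theorem exists_minimalDilation (Φ : C →L[ℂ] (K →L[ℂ] K)) (hstar : ∀ x, Φ (star x) = star (Φ x))
    (hpos : ∀ (n : ℕ) (c : Fin n → C) (k : Fin n → K),
      0 ≤ (∑ i, ∑ j, ⟪k i, Φ (star (c i) * c j) (k j)⟫_ℂ).re) :
    ∃ (H : Type (max u w)) (_ : NormedAddCommGroup H) (_ : InnerProductSpace ℂ H)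
      (_ : CompleteSpace H) (π : C →⋆ₙₐ[ℂ] (H →L[ℂ] H)) (V : K →L[ℂ] H),
      (∀ x, Φ x = V.adjoint ∘L π x ∘L V) ∧ IsMinimalDilation π V := by
  set B := stinespringForm (Φ : C →ₗ[ℂ] (K →L[ℂ] K))
  have hB : ∀ c d k l, B (c ⊗ₜ k) (d ⊗ₜ l) = ⟪k, Φ (star c * d) l⟫_ℂ := fun _ _ _ _ => rfl
  have hadjΦ : ∀ x k l, ⟪k, Φ (star x) l⟫_ℂ = ⟪Φ x k, l⟫_ℂ := fun x k l => by
    rw [hstar, ContinuousLinearMap.star_eq_adjoint, ContinuousLinearMap.adjoint_inner_right]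
  have hsymm : ∀ x y, star (B y x) = B x y := by
    intro x y
    induction x using TensorProduct.induction_on with
    | zero => simp
    | add x x' hx hx' => simp only [map_add, star_add, hx, hx', LinearMap.add_apply]
    | tmul c k =>
      induction y using TensorProduct.induction_on with
      | zero => simp
      | add x x' hx hx' => simp only [map_add, star_add, hx, hx', LinearMap.add_apply]
      | tmul d l =>
        rw [hB, hB, ← star_star d, ← star_mul, star_star, hadjΦ, ← inner_conj_symm]
        exact star_star _
  have hposB : ∀ x, 0 ≤ (B x x).re := by
    intro x
    obtain ⟨n, c, k, rfl⟩ := TensorProduct.exists_sum_tmul_eq x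
    simp only [map_sum, LinearMap.sum_apply, hB]
    rw [Finset.sum_comm]
    simpa using hpos n c k
  -- Coefficients are bounded linearly in the norm of the acting element. Along the iterated squares
  -- of `r⋆ r` this gives geometric growth of ratio `‖r⋆ r‖`, so every element of `C` may serve as a
  -- generator below.
  have hbd : ∀ x y, ∃ M : ℝ, ∀ q, ‖B x (stinespringAction C K q y)‖ ≤ M * ‖q‖ := by
    intro x y
    induction x using TensorProduct.induction_on with
    | zero => exact ⟨0, fun q => by simp⟩
    | add x x' hx hx' =>
      obtain ⟨M, hM⟩ := hx
      obtain ⟨N, hN⟩ := hx'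
      refine ⟨M + N, fun q => ?_⟩
      rw [map_add, LinearMap.add_apply, add_mul]
      exact (norm_add_le _ _).trans (add_le_add (hM q) (hN q))
    | tmul c k =>
      induction y using TensorProduct.induction_on with
      | zero => exact ⟨0, fun q => by simp⟩
      | add x x' hx hx' =>
        obtain ⟨M, hM⟩ := hx
        obtain ⟨N, hN⟩ := hx'
        refine ⟨M + N, fun q => ?_⟩
        rw [map_add, map_add, add_mul]
        exact (norm_add_le _ _).trans (add_le_add (hM q) (hN q))
      | tmul d l =>
        refine ⟨‖k‖ * (‖Φ‖ * (‖c‖ * ‖d‖) * ‖l‖), fun q => ?_⟩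
        rw [stinespringAction_tmul, hB]
        calc _ ≤ ‖k‖ * ‖Φ (star c * (q * d)) l‖ := norm_inner_le_norm _ _
          _ ≤ ‖k‖ * (‖Φ‖ * (‖star c‖ * (‖q‖ * ‖d‖)) * ‖l‖) := by
            gcongr
            refine (Φ _).le_of_opNorm_le (Φ.le_of_opNorm_le_of_le le_rfl ?_) l
            exact (norm_mul_le _ _).trans (by gcongr; exact norm_mul_le _ _)
          _ = _ := by rw [norm_star]; ring
  obtain ⟨H, _, _, _, ι, π, hι, hin, hπ⟩ := exists_rep_of_form B hsymm hposB
    (stinespringAction C K)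
    (fun r s x => by
      induction x using TensorProduct.induction_on with
      | zero => simp
      | add x x' hx hx' => simp only [map_add, hx, hx']
      | tmul c k => simp only [stinespringAction_tmul, mul_assoc])
    (fun r x y => by
      induction x using TensorProduct.induction_on with
      | zero => simp
      | add x x' hx hx' => simp only [map_add, LinearMap.add_apply, hx, hx']
      | tmul c k =>
        induction y using TensorProduct.induction_on with
        | zero => simp
        | add x x' hx hx' => simp only [map_add, hx, hx']
        | tmul d l => simp only [stinespringAction_tmul, hB, star_mul, mul_assoc])
    Set.univ Submodule.span_univ (fun r _ => by
      obtain ⟨q, hq₀, hq, hqn⟩ := exists_squares (star r * r)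
      refine ⟨q, ‖star r * r‖, hq₀, hq, norm_nonneg _, fun x => ?_⟩
      obtain ⟨M, hM⟩ := hbd x x
      refine ⟨|M|, fun n => (hM (q n)).trans ?_⟩
      gcongr
      · exact le_abs_self M
      · exact hqn n)
  -- Without a unit there is no vector `1 ⊗ k` with which to define `V k`. Instead `V` is obtained
  -- as the adjoint of the extension `W` of `c ⊗ k ↦ Φ(c) k`.
  let W₀ : C ⊗[ℂ] K →ₗ[ℂ] K := TensorProduct.lift
    (LinearMap.mk₂ ℂ (fun c k => Φ c k) (by simp) (by simp) (by simp) (by simp))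
  have hW₀ : ∀ c k, W₀ (c ⊗ₜ k) = Φ c k := fun _ _ => rfl
  have happ := CStarAlgebra.increasingApproximateUnit C
  have hlim : ∀ (η : K) x, Tendsto (fun e : C => B (e ⊗ₜ η) x) (CStarAlgebra.approximateUnit C)
      (𝓝 ⟪η, W₀ x⟫_ℂ) := by
    intro η x
    induction x using TensorProduct.induction_on with
    | zero => simp
    | add x y hx hy => simpa only [map_add, inner_add_right] using hx.add hy
    | tmul c k =>
      simp only [hB, hW₀]
      have h1 : Tendsto (fun e : C => star e * c) (CStarAlgebra.approximateUnit C) (𝓝 c) :=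
        (happ.tendsto_mul_right c).congr' (happ.eventually_star_eq.mono fun e he => by
          simp only [he])
      have h2 : Continuous fun x => ⟪η, Φ x k⟫_ℂ := by fun_prop
      exact (h2.tendsto c).comp h1
  have hWbd : ∀ x, ‖W₀ x‖ ≤ √‖Φ‖ * ‖ι x‖ := by
    intro x
    -- By `hlim` the left side is the limit of `‖⟨e ⊗ η, x⟩‖` along an approximate unit. The
    -- constant comes from `‖e ⊗ η‖² = ⟨η, Φ(e⋆ e) η⟩ ≤ ‖Φ‖ ‖η‖²`.
    have key : ∀ η : K, ‖⟪η, W₀ x⟫_ℂ‖ ≤ √‖Φ‖ * ‖η‖ * ‖ι x‖ := by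
      intro η
      refine le_of_tendsto (hlim η x).norm (happ.eventually_norm.mono fun e he => ?_)
      rw [← hin]
      refine (norm_inner_le_norm _ _).trans ?_
      gcongr
      refine le_of_sq_le_sq ?_ (by positivity)
      rw [mul_pow, Real.sq_sqrt (norm_nonneg _)]
      have h1 : ‖ι (e ⊗ₜ η)‖ ^ 2 = ‖⟪η, Φ (star e * e) η⟫_ℂ‖ := by
        rw [← hB, ← hin, inner_self_eq_norm_sq_to_K]
        simp
      rw [h1]
      calc _ ≤ ‖η‖ * ‖Φ (star e * e) η‖ := norm_inner_le_norm _ _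
        _ ≤ ‖η‖ * (‖Φ‖ * 1 * ‖η‖) := by
          gcongr
          refine (Φ _).le_of_opNorm_le (Φ.le_of_opNorm_le_of_le le_rfl ?_) η
          rw [CStarRing.norm_star_mul_self]
          exact mul_le_one₀ he (norm_nonneg _) he
        _ = _ := by ring
    have := key (W₀ x)
    rw [inner_self_eq_norm_sq_to_K] at this
    simp only [norm_pow, RCLike.norm_ofReal, abs_norm] at this
    rcases (norm_nonneg (W₀ x)).eq_or_lt with h | h
    · rw [← h]; positivity
    · refine le_of_mul_le_mul_left ?_ h
      linarith
  let W : H →L[ℂ] K := W₀.extendOfNorm ι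
  have hW : ∀ x, W (ι x) = W₀ x := fun x => LinearMap.extendOfNorm_eq hι ⟨_, hWbd⟩ x
  have hin' : ∀ c k y, ⟪W₀ (stinespringAction C K (star c) y), k⟫_ℂ = B y (c ⊗ₜ k) := by
    intro c k y
    induction y using TensorProduct.induction_on with
    | zero => simp
    | add x y hx hy => simp only [map_add, inner_add_left, hx, hy, LinearMap.add_apply]
    | tmul d l => rw [stinespringAction_tmul, hW₀, hB, ← hadjΦ, star_mul, star_star]
  -- This identity yields both the dilation formula, on applying `W`, and minimality, since the
  -- vectors `ι (c ⊗ k)` span a dense subspace.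
  have hV : ∀ c k, π c (W.adjoint k) = ι (c ⊗ₜ k) := by
    intro c k
    refine ext_inner_left ℂ fun h => ?_
    induction h using hι.induction_on with
    | hp => exact isClosed_eq (by fun_prop) (by fun_prop)
    | ih y =>
      rw [hin, ← hin', ← hW, ← hπ, map_star, ContinuousLinearMap.star_eq_adjoint,
        ← ContinuousLinearMap.adjoint_inner_right, ContinuousLinearMap.adjoint_inner_left]
  refine ⟨H, inferInstance, inferInstance, inferInstance, π, W.adjoint, fun x => ?_, ?_⟩
  · ext k
    simp [hV, hW, hW₀]
  · refine hι.mono ?_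
    rintro _ ⟨x, rfl⟩
    induction x using TensorProduct.induction_on with
    | zero => simp
    | add x y hx hy => rw [map_add]; exact add_mem hx hy
    | tmul c k => exact Submodule.subset_span ⟨c, k, (hV c k).symm⟩

/-- The kernel `(c, d) ↦ Φ(c⋆ d)` of a completely positive map is positive definite. -/
theorem re_sum_inner_nonneg (Φ : C →CP (K →L[ℂ] K)) (n : ℕ) (c : Fin n → C) (k : Fin n → K) :
    0 ≤ (∑ i, ∑ j, ⟪k i, Φ (star (c i) * c j) (k j)⟫_ℂ).re := by
  obtain ⟨Y, hY⟩ := exists_eq_sum_star_mul_of_nonneg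
    (CompletelyPositiveMap.map_cstarMatrix_nonneg Φ _ (gram_nonneg c))
  have hY' : ∀ i j, Φ (star (c i) * c j) = ∑ m, star (Y m i) * Y m j := hY
  -- Factoring the positive matrix `Φ(c_i⋆ c_j)` as `Y⋆ Y` turns the double sum into `∑ₘ ‖∑ᵢ Y m i
  -- (k i)‖²`.
  have hsum : ∑ i, ∑ j, ⟪k i, Φ (star (c i) * c j) (k j)⟫_ℂ
      = ∑ m, ⟪∑ i, Y m i (k i), ∑ j, Y m j (k j)⟫_ℂ := by
    simp only [hY', sum_apply, inner_sum, sum_inner,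
      mul_apply_eq_comp, ContinuousLinearMap.star_eq_adjoint,
      ContinuousLinearMap.adjoint_inner_right]
    rw [Finset.sum_comm_cycle]
    refine Finset.sum_congr rfl fun m _ => Finset.sum_comm
  rw [hsum, Complex.re_sum]
  exact Finset.sum_nonneg fun m _ => inner_self_nonneg (𝕜 := ℂ)

/-- Stinespring's theorem. -/
theorem exists_isStinespringDilation (Φ : C →CP (K →L[ℂ] K)) :
    ∃ (H : Type (max u w)) (_ : NormedAddCommGroup H) (_ : InnerProductSpace ℂ H)
      (_ : CompleteSpace H) (π : C →⋆ₙₐ[ℂ] (H →L[ℂ] H)) (V : K →L[ℂ] H),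
      IsStinespringDilation Φ π V ∧ IsMinimalDilation π V := by
  obtain ⟨H, _, _, _, π, V, h, hmin⟩ := exists_minimalDilation
    (⟨(Φ : C →ₗ[ℂ] (K →L[ℂ] K)), map_continuous Φ⟩ : C →L[ℂ] (K →L[ℂ] K))
    (fun x => map_star Φ x) (re_sum_inner_nonneg Φ)
  exact ⟨H, _, _, _, π, V, ⟨hmin.nondegenerate, h⟩, hmin⟩

/-- Every state has a GNS representation. -/
theorem exists_isGNS {f : C →L[ℂ] ℂ} (hf : IsState f) :
    ∃ (H : Type u) (_ : NormedAddCommGroup H) (_ : InnerProductSpace ℂ H)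
      (_ : CompleteSpace H) (π : C →⋆ₙₐ[ℂ] (H →L[ℂ] H)) (ξ : H), IsGNS f π ξ := by
  have hΦ : ∀ x z w, ⟪z, f.smulRight (1 : ℂ →L[ℂ] ℂ) x w⟫_ℂ = star z * f x * w := fun x z w => by
    simp only [ContinuousLinearMap.smulRight_apply, smul_apply, one_apply_eq_self,
      smul_eq_mul, RCLike.inner_apply]
    exact by rw [mul_comm, mul_assoc]; rfl
  -- GNS is the Stinespring construction on `K = ℂ` for the map `x ↦ f(x) · 1`, with cyclic vector
  -- `V 1`.
  obtain ⟨H, _, _, _, π, V, h, hmin⟩ := exists_minimalDilation (f.smulRight (1 : ℂ →L[ℂ] ℂ))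
    (fun x => by
      rw [ContinuousLinearMap.smulRight_apply, ContinuousLinearMap.smulRight_apply, hf.apply_star,
        star_smul, star_one])
    (fun n c k => by
      have : ∑ i, ∑ j, ⟪k i, f.smulRight (1 : ℂ →L[ℂ] ℂ) (star (c i) * c j) (k j)⟫_ℂ =
          f (star (∑ i, k i • c i) * ∑ i, k i • c i) := by
        simp only [hΦ, star_sum, Finset.sum_mul_sum, map_sum, star_smul, smul_mul_smul_comm,
          map_smul, smul_eq_mul]
        exact Finset.sum_congr rfl fun i _ => Finset.sum_congr rfl fun j _ => by ring
      rw [this]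
      exact (Complex.nonneg_iff.mp (hf.1 _)).1)
  refine ⟨H, _, _, _, π, V 1, ?_, fun x => ?_⟩
  · refine hmin.mono (Submodule.span_le (p := LinearMap.range
      ((LinearMap.applyₗ (V 1)) ∘ₗ (ContinuousLinearMap.coeLM ℂ) ∘ₗ (π : C →ₗ[ℂ] (H →L[ℂ] H)))
        ).mpr ?_)
    rintro _ ⟨x, k, rfl⟩
    refine ⟨k • x, ?_⟩
    change π (k • x) (V 1) = π x (V k)
    rw [map_smul, smul_apply, ← map_smul, ← map_smul, smul_eq_mul, mul_one]
  · rw [← ContinuousLinearMap.adjoint_inner_right]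
    change _ = ⟪(1 : ℂ), (V.adjoint ∘L π x ∘L V) 1⟫_ℂ
    rw [← h, hΦ]
    simp

end Stinespring

/-! ### The even expectation on the algebraic Fermi tensor product -/

section EvenMap

variable {A : Type u} {B : Type v} [NonUnitalCStarAlgebra A] [NonUnitalCStarAlgebra B]

namespace Z2Grading

variable (θ : Z2Grading A)

lemma norm_auto (a : A) : ‖θ.auto a‖ = ‖a‖ :=
  NonUnitalStarAlgHom.norm_map θ.auto (EquivLike.injective θ.auto) a

lemma norm_proj_le (i : ℤˣ) (a : A) : ‖θ.proj i a‖ ≤ ‖a‖ := by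
  rw [proj_apply, norm_smul]
  have h : ‖a + ((i : ℤ) : ℂ) • θ.auto a‖ ≤ ‖a‖ + ‖a‖ := by
    refine (norm_add_le _ _).trans (add_le_add le_rfl ?_)
    rw [norm_smul, θ.norm_auto]
    rcases Int.units_eq_one_or i with rfl | rfl <;> simp
  have h2 : ‖(1 / 2 : ℂ)‖ = 1 / 2 := by norm_num
  rw [h2]
  linarith

lemma coe_evenExpectation (a : A) : (θ.evenExpectation a : A) = θ.proj 1 a := rfl

lemma norm_evenExpectation_le (a : A) : ‖θ.evenExpectation a‖ ≤ ‖a‖ := θ.norm_proj_le 1 a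

lemma evenExpectation_coe (a : θ.evenPart) : θ.evenExpectation (a : A) = a :=
  Subtype.ext (θ.proj_eq_of_auto (by simpa using θ.mem_evenPart.mp a.2))

lemma evenExpectation_star (a : A) : θ.evenExpectation (star a) = star (θ.evenExpectation a) :=
  Subtype.ext (θ.proj_star 1 a)

lemma evenExpectation_auto (a : A) : θ.evenExpectation (θ.auto a) = θ.evenExpectation a :=
  Subtype.ext (by simp [coe_evenExpectation, proj_apply, θ.involutive, add_comm])

lemma auto_coe (b : θ.evenPart) : θ.auto (b : A) = b := b.2

/-- The even parts of the entries of a Gram matrix form a Gram matrix over the even part. -/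
theorem exists_evenExpectation_gram {n : ℕ} (a : Fin n → A) :
    ∃ c : Fin n → Fin n → θ.evenPart, ∀ k l,
      θ.evenExpectation (star (a k) * a l) = ∑ m, star (c m k) * c m l := by
  let _ : PartialOrder A := CStarAlgebra.spectralOrder A
  let _ : StarOrderedRing A := CStarAlgebra.spectralOrderedRing A
  let T : CStarMatrix (Fin n) (Fin n) A →⋆ₙₐ[ℂ] CStarMatrix (Fin n) (Fin n) A :=
    CStarMatrix.mapₙₐ (θ.auto : A →⋆ₙₐ[ℂ] A)
  have hT : ∀ M i j, T M i j = θ.auto (M i j) := fun _ _ _ => rfl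
  let G : CStarMatrix (Fin n) (Fin n) A := CStarMatrix.ofMatrix fun i j => star (a i) * a j
  have hG : 0 ≤ G := gram_nonneg a
  -- Uniqueness of the positive square root: a `*`-endomorphism fixing `x ≥ 0` also fixes `√x`.
  have key : ∀ {D : Type u} [NonUnitalCStarAlgebra D] [PartialOrder D] [StarOrderedRing D]
      (T : D →⋆ₙₐ[ℂ] D) (x : D), 0 ≤ x → T x = x → ∃ s, star s * s = x ∧ T s = s := by
    intro D _ _ _ T x hx hTx
    have hs : 0 ≤ CFC.sqrt x := CFC.sqrt_nonneg x
    refine ⟨CFC.sqrt x, ?_, ?_⟩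
    · rw [(IsSelfAdjoint.of_nonneg hs).star_eq, CFC.sqrt_mul_sqrt_self x hx]
    · refine (CFC.sqrt_unique ?_ (map_nonneg T hs)).symm
      rw [← map_mul, CFC.sqrt_mul_sqrt_self x hx, hTx]
  have hpos : 0 ≤ (1 / 2 : ℂ) • (G + T G) := half_smul_nonneg (add_nonneg hG (map_nonneg T hG))
  have hTG : T (T G) = G := CStarMatrix.ext fun i j => by rw [hT, hT, θ.involutive]
  obtain ⟨s, hs, hTs⟩ := key T _ hpos (by rw [map_smul, map_add, hTG, add_comm])
  refine ⟨fun m k => ⟨s m k, by rw [mem_evenPart, ← hT, hTs]⟩, fun k l => Subtype.ext ?_⟩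
  have := congrFun (congrFun hs k) l
  rw [CStarMatrix.mul_apply] at this
  rw [coe_evenExpectation, proj_apply]
  simp only [Units.val_one, Int.cast_one, one_smul]
  refine this.symm.trans ?_
  rw [AddSubmonoidClass.coe_finsetSum]
  rfl

end Z2Grading

namespace FermiTensor

variable (α : Z2Grading A) (β : Z2Grading B)

/-- The map `a Ⓕ b ↦ ε(a) ⊗ b` on the algebraic Fermi tensor product. -/
def evenMap : FermiTensor α β →ₗ[ℂ] α.evenPart ⊗[ℂ] B :=
  TensorProduct.map α.evenExpectation LinearMap.id ∘ₗ (ofTensor α β).symm.toLinearMap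

/-- The `*`-automorphism `a Ⓕ b ↦ α(a) Ⓕ b` of the algebraic Fermi tensor product. -/
def leftAutoₗ : FermiTensor α β →ₗ[ℂ] FermiTensor α β :=
  (ofTensor α β).toLinearMap ∘ₗ TensorProduct.map (α.auto : A →ₗ[ℂ] A) LinearMap.id ∘ₗ
    (ofTensor α β).symm.toLinearMap

/-- The inclusion `a ⊗ b ↦ a Ⓕ b` of `A₊ ⊗ B`, as a linear map. -/
def inclₗ : α.evenPart ⊗[ℂ] B →ₗ[ℂ] FermiTensor α β :=
  (ofTensor α β).toLinearMap ∘ₗ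
    TensorProduct.map (NonUnitalStarSubalgebraClass.subtype α.evenPart : α.evenPart →ₗ[ℂ] A) LinearMap.id

variable {α β}

lemma evenMap_tmul (a : A) (b : B) :
    evenMap α β (tmul α β a b) = α.evenExpectation a ⊗ₜ b := rfl

lemma leftAutoₗ_tmul (a : A) (b : B) :
    leftAutoₗ α β (tmul α β a b) = tmul α β (α.auto a) b := rfl

lemma inclₗ_tmul (a : α.evenPart) (b : B) :
    inclₗ α β (a ⊗ₜ b) = tmul α β (a : A) b := rfl

lemma tmul_mul_coe (a : A) (b : B) (a' : α.evenPart) (b' : B) :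
    tmul α β a b * tmul α β (a' : A) b' = tmul α β (a * a') (b * b') := by
  rw [tmul_mul_tmul, α.auto_coe, ← tmul_add, ← add_mul, β.proj_one_add_proj_neg_one]

lemma star_tmul_coe (a : α.evenPart) (b : B) :
    star (tmul α β (a : A) b) = tmul α β (star (a : A)) (star b) := by
  rw [star_tmul, α.auto_coe, ← tmul_add, ← star_add, β.proj_one_add_proj_neg_one]

variable (α β)

/-- The automorphism `a Ⓕ b ↦ α(a) Ⓕ b`. -/
def leftAuto : FermiTensor α β →⋆ₙₐ[ℂ] FermiTensor α β where
  toFun := leftAutoₗ α β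
  map_smul' := map_smul _
  map_zero' := map_zero _
  map_add' := map_add _
  map_mul' x y := by
    induction x using induction_on with
    | zero => simp only [zero_mul, map_zero]
    | add x x' hx hx' => simp only [add_mul, map_add, hx, hx']
    | tmul a b =>
      induction y using induction_on with
      | zero => simp only [mul_zero, map_zero]
      | add x x' hx hx' => simp only [mul_add, map_add, hx, hx']
      | tmul a' b' => simp only [tmul_mul_tmul, map_add, leftAutoₗ_tmul, map_mul]
  map_star' x := by
    induction x using induction_on with
    | zero => simp only [star_zero, map_zero]
    | add x x' hx hx' => simp only [star_add, map_add, hx, hx']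
    | tmul a b => simp only [star_tmul, map_add, leftAutoₗ_tmul, map_star]

/-- The inclusion `a ⊗ b ↦ a Ⓕ b` of `A₊ ⊗ B`. -/
def incl : α.evenPart ⊗[ℂ] B →⋆ₙₐ[ℂ] FermiTensor α β where
  toFun := inclₗ α β
  map_smul' := map_smul _
  map_zero' := map_zero _
  map_add' := map_add _
  map_mul' x y := by
    induction x using TensorProduct.induction_on with
    | zero => simp only [zero_mul, map_zero]
    | add x x' hx hx' => simp only [add_mul, map_add, hx, hx']
    | tmul a b =>
      induction y using TensorProduct.induction_on with
      | zero => simp only [mul_zero, map_zero]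
      | add x x' hx hx' => simp only [mul_add, map_add, hx, hx']
      | tmul a' b' =>
        simp only [Algebra.TensorProduct.tmul_mul_tmul, inclₗ_tmul, tmul_mul_coe]
        rfl
  map_star' x := by
    induction x using TensorProduct.induction_on with
    | zero => simp only [star_zero, map_zero]
    | add x x' hx hx' => simp only [star_add, map_add, hx, hx']
    | tmul a b =>
      simp only [TensorProduct.star_tmul, inclₗ_tmul, star_tmul_coe]
      rfl

variable {α β}

lemma leftAuto_tmul (a : A) (b : B) :
    leftAuto α β (tmul α β a b) = tmul α β (α.auto a) b := rfl

lemma incl_tmul (a : α.evenPart) (b : B) : incl α β (a ⊗ₜ b) = tmul α β (a : A) b := rfl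

lemma leftAuto_incl (y : α.evenPart ⊗[ℂ] B) : leftAuto α β (incl α β y) = incl α β y := by
  induction y using TensorProduct.induction_on with
  | zero => simp only [map_zero]
  | add x y hx hy => simp only [map_add, hx, hy]
  | tmul a b => rw [incl_tmul, leftAuto_tmul, α.auto_coe]

/-- Seen inside the Fermi product, `ε ⊗ id` is the average over an involutive automorphism.
Contractivity and complete positivity of its extension to the completions both come from this
formula. -/
lemma incl_evenMap (x : FermiTensor α β) :
    incl α β (evenMap α β x) = (1 / 2 : ℂ) • (x + leftAuto α β x) := by
  induction x using induction_on with
  | zero => simp only [map_zero, add_zero, smul_zero]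
  | add x y hx hy => simp only [map_add, hx, hy]; module
  | tmul a b =>
    rw [evenMap_tmul, incl_tmul, leftAuto_tmul, α.coe_evenExpectation, Z2Grading.proj_apply,
      ← add_tmul, ← smul_tmul]
    simp

lemma evenMap_incl (y : α.evenPart ⊗[ℂ] B) : evenMap α β (incl α β y) = y := by
  induction y using TensorProduct.induction_on with
  | zero => simp only [map_zero]
  | add x y hx hy => simp only [map_add, hx, hy]
  | tmul a b => rw [incl_tmul, evenMap_tmul, α.evenExpectation_coe]

lemma evenMap_star (x : FermiTensor α β) : evenMap α β (star x) = star (evenMap α β x) := by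
  induction x using induction_on with
  | zero => simp only [map_zero, star_zero]
  | add x y hx hy => simp only [map_add, star_add, hx, hy]
  | tmul a b =>
    rw [star_tmul, map_add, evenMap_tmul, evenMap_tmul, evenMap_tmul, TensorProduct.star_tmul,
      α.evenExpectation_star, α.evenExpectation_star, α.evenExpectation_auto,
      ← TensorProduct.tmul_add, ← star_add, β.proj_one_add_proj_neg_one]

/-- In the involution and in the product, an odd right leg costs one application of `α` to the left
leg. In `(a Ⓕ b)⋆ (a' Ⓕ b')` the odd part of `b` therefore appears with `α(a⋆ a')`, and `ε ∘ α = ε`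
removes the twist, after which the two parts of `b` recombine. -/
lemma evenMap_star_tmul_mul_tmul (a a' : A) (b b' : B) :
    evenMap α β (star (tmul α β a b) * tmul α β a' b') =
      α.evenExpectation (star a * a') ⊗ₜ (star b * b') := by
  simp only [star_tmul, add_mul, tmul_mul_tmul, map_add, evenMap_tmul, β.proj_star,
    Z2Grading.proj_one_proj_one, Z2Grading.proj_neg_one_proj_neg_one,
    Z2Grading.proj_neg_one_proj_one, Z2Grading.proj_one_proj_neg_one, star_zero, zero_mul,
    TensorProduct.tmul_zero, add_zero, zero_add, ← map_star α.auto, ← map_mul α.auto,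
    α.evenExpectation_auto]
  rw [← TensorProduct.tmul_add, ← add_mul, ← star_add, β.proj_one_add_proj_neg_one]

/-- The map `ε ⊗ id` sends squares to sums of squares. -/
theorem exists_evenMap_star_mul_self (x : FermiTensor α β) :
    ∃ (n : ℕ) (y : Fin n → α.evenPart ⊗[ℂ] B),
      evenMap α β (star x * x) = ∑ m, star (y m) * y m := by
  obtain ⟨n, a, b, hx⟩ : ∃ (n : ℕ) (a : Fin n → A) (b : Fin n → B),
      x = ∑ k, tmul α β (a k) (b k) := by
    obtain ⟨n, a, b, h⟩ := TensorProduct.exists_sum_tmul_eq ((ofTensor α β).symm x)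
    refine ⟨n, a, b, ?_⟩
    rw [LinearEquiv.symm_apply_eq, map_sum] at h
    exact h
  obtain ⟨c, hc⟩ := α.exists_evenExpectation_gram a
  refine ⟨n, fun m => ∑ k, c m k ⊗ₜ b k, ?_⟩
  rw [hx]
  simp only [star_sum, Finset.sum_mul_sum, map_sum, evenMap_star_tmul_mul_tmul, hc,
    TensorProduct.star_tmul, Algebra.TensorProduct.tmul_mul_tmul, TensorProduct.sum_tmul]
  rw [Finset.sum_comm_cycle]

end FermiTensor

end EvenMap

/-! ### GNS representations of the algebraic Fermi tensor product -/

section FermiRepresentations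

variable {A : Type u} {B : Type v} [NonUnitalCStarAlgebra A] [NonUnitalCStarAlgebra B]

namespace FermiTensor

variable {α : Z2Grading A} {β : Z2Grading B}

/-- A functional on the Fermi tensor product is elementarily bounded if it is bounded as a bilinear
map on `A × B`. -/
def ElementarilyBounded (f : FermiTensor α β →ₗ[ℂ] ℂ) : Prop :=
  ∃ C : ℝ, ∀ a b, ‖f (tmul α β a b)‖ ≤ C * (‖a‖ * ‖b‖)

lemma ElementarilyBounded.exists_nonneg {f : FermiTensor α β →ₗ[ℂ] ℂ}
    (hf : ElementarilyBounded f) :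
    ∃ C : ℝ, 0 ≤ C ∧ ∀ a b, ‖f (tmul α β a b)‖ ≤ C * (‖a‖ * ‖b‖) := by
  obtain ⟨C, hC⟩ := hf
  exact ⟨|C|, abs_nonneg C, fun a b => (hC a b).trans (by gcongr; exact le_abs_self C)⟩

/-- With `ElementarilyBounded.comp_mulRight` this bounds `r ↦ f(x⋆ r x)` on elementary tensors,
which is the growth condition in the GNS construction. Grading projections are contractive and `α`
is isometric, so each of the two terms of a product contributes the same bound. -/
lemma ElementarilyBounded.comp_mulLeft {f : FermiTensor α β →ₗ[ℂ] ℂ}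
    (hf : ElementarilyBounded f) (x : FermiTensor α β) :
    ElementarilyBounded (f ∘ₗ LinearMap.mulLeft ℂ x) := by
  induction x using induction_on with
  | zero => exact ⟨0, fun a b => by simp⟩
  | add x y hx hy =>
    obtain ⟨C, hC⟩ := hx
    obtain ⟨D, hD⟩ := hy
    refine ⟨C + D, fun a b => ?_⟩
    simp only [LinearMap.comp_apply, LinearMap.mulLeft_apply, add_mul, map_add] at hC hD ⊢
    exact (norm_add_le _ _).trans (add_le_add (hC a b) (hD a b))
  | tmul c d =>
    obtain ⟨C, h0, hC⟩ := hf.exists_nonneg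
    refine ⟨C * (‖c‖ * ‖d‖) + C * (‖c‖ * ‖d‖), fun a b => ?_⟩
    simp only [LinearMap.comp_apply, LinearMap.mulLeft_apply, tmul_mul_tmul, map_add, add_mul]
    refine (norm_add_le _ _).trans (add_le_add ?_ ?_)
    · calc _ ≤ C * (‖c * a‖ * ‖β.proj 1 d * b‖) := hC _ _
        _ ≤ C * ((‖c‖ * ‖a‖) * (‖d‖ * ‖b‖)) := by
          gcongr
          · exact norm_mul_le _ _
          · exact (norm_mul_le _ _).trans (by gcongr; exact β.norm_proj_le 1 d)
        _ = _ := by ring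
    · calc _ ≤ C * (‖c * α.auto a‖ * ‖β.proj (-1) d * b‖) := hC _ _
        _ ≤ C * ((‖c‖ * ‖a‖) * (‖d‖ * ‖b‖)) := by
          gcongr
          · exact (norm_mul_le _ _).trans (by rw [α.norm_auto])
          · exact (norm_mul_le _ _).trans (by gcongr; exact β.norm_proj_le (-1) d)
        _ = _ := by ring

lemma ElementarilyBounded.comp_mulRight {f : FermiTensor α β →ₗ[ℂ] ℂ}
    (hf : ElementarilyBounded f) (x : FermiTensor α β) :
    ElementarilyBounded (f ∘ₗ LinearMap.mulRight ℂ x) := by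
  induction x using induction_on with
  | zero => exact ⟨0, fun a b => by simp⟩
  | add x y hx hy =>
    obtain ⟨C, hC⟩ := hx
    obtain ⟨D, hD⟩ := hy
    refine ⟨C + D, fun a b => ?_⟩
    simp only [LinearMap.comp_apply, LinearMap.mulRight_apply, mul_add, map_add, add_mul]
      at hC hD ⊢
    exact (norm_add_le _ _).trans (add_le_add (hC a b) (hD a b))
  | tmul c d =>
    obtain ⟨C, h0, hC⟩ := hf.exists_nonneg
    refine ⟨C * (‖c‖ * ‖d‖) + C * (‖c‖ * ‖d‖), fun a b => ?_⟩
    simp only [LinearMap.comp_apply, LinearMap.mulRight_apply, tmul_mul_tmul, map_add, add_mul]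
    refine (norm_add_le _ _).trans (add_le_add ?_ ?_)
    · calc _ ≤ C * (‖a * c‖ * ‖β.proj 1 b * d‖) := hC _ _
        _ ≤ C * ((‖a‖ * ‖c‖) * (‖b‖ * ‖d‖)) := by
          gcongr
          · exact norm_mul_le _ _
          · exact (norm_mul_le _ _).trans (by gcongr; exact β.norm_proj_le 1 b)
        _ = _ := by ring
    · calc _ ≤ C * (‖a * α.auto c‖ * ‖β.proj (-1) b * d‖) := hC _ _
        _ ≤ C * ((‖a‖ * ‖c‖) * (‖b‖ * ‖d‖)) := by
          gcongr
          · exact (norm_mul_le _ _).trans (by rw [α.norm_auto])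
          · exact (norm_mul_le _ _).trans (by gcongr; exact β.norm_proj_le (-1) b)
        _ = _ := by ring

/-- Involution and product together apply `α` to `a⋆ a` on the odd part of `b`. As `a⋆ a` is even,
no sign survives, whatever the parity of `b`. -/
lemma star_tmul_mul_self {a : A} (ha : α.auto (star a * a) = star a * a) (b : B) :
    star (tmul α β a b) * tmul α β a b = tmul α β (star a * a) (star b * b) := by
  have h0 : ∀ a : A, tmul α β a 0 = 0 := fun a => by simp [tmul]
  simp only [star_tmul, add_mul, tmul_mul_tmul, β.proj_star,
    Z2Grading.proj_one_proj_one, Z2Grading.proj_neg_one_proj_neg_one,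
    Z2Grading.proj_neg_one_proj_one, Z2Grading.proj_one_proj_neg_one, star_zero, zero_mul,
    h0, add_zero, zero_add, ← map_star α.auto, ← map_mul α.auto, ha]
  rw [← tmul_add, ← add_mul, ← star_add, β.proj_one_add_proj_neg_one]

/-- Homogeneity of the left leg alone makes `a⋆ a` even, which is all that `star_tmul_mul_self`
needs. -/
lemma span_tmul_homogeneous :
    Submodule.span ℂ {x | ∃ (i : ℤˣ) (a : A) (b : B), x = tmul α β (α.proj i a) b} = ⊤ := by
  refine eq_top_iff.mpr fun x _ => ?_
  induction x using induction_on with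
  | zero => exact zero_mem _
  | add x y hx hy => exact add_mem (hx trivial) (hy trivial)
  | tmul a b =>
    rw [← α.proj_one_add_proj_neg_one a, add_tmul]
    exact add_mem (Submodule.subset_span ⟨1, a, b, rfl⟩) (Submodule.subset_span ⟨-1, a, b, rfl⟩)

/-- The GNS construction for an elementarily bounded positive functional on the algebraic Fermi
tensor product. -/
theorem exists_gns_rep (f : FermiTensor α β →ₗ[ℂ] ℂ) (hf : ElementarilyBounded f)
    (hstar : ∀ x, f (star x) = star (f x)) (hpos : ∀ x, 0 ≤ (f (star x * x)).re) :
    ∃ (H : Type (max u v)) (_ : NormedAddCommGroup H) (_ : InnerProductSpace ℂ H)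
      (_ : CompleteSpace H) (ι : FermiTensor α β →ₗ[ℂ] H)
      (π : FermiTensor α β →⋆ₙₐ[ℂ] (H →L[ℂ] H)),
      (∀ x y, ⟪ι x, ι y⟫_ℂ = f (star x * y)) ∧ ∀ r x, π r (ι x) = ι (r * x) := by
  obtain ⟨H, _, _, _, ι, π, -, h1, h2⟩ := exists_rep_of_form
    (LinearMap.mk₂'ₛₗ (starRingEnd ℂ) (RingHom.id ℂ) (fun x y => f (star x * y))
      (fun x x' y => by rw [star_add, add_mul, map_add])
      (fun z x y => by rw [star_smul, smul_mul_assoc, map_smul]; rfl)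
      (fun x y y' => by rw [mul_add, map_add])
      (fun z x y => by rw [mul_smul_comm, map_smul]; rfl))
    (fun x y => by
      simp only [LinearMap.mk₂'ₛₗ_apply]
      rw [← hstar, star_mul, star_star])
    hpos (LinearMap.mul ℂ (FermiTensor α β)) (fun r s x => mul_assoc r s x)
    (fun r x y => by
      simp only [LinearMap.mk₂'ₛₗ_apply, LinearMap.mul_apply']
      rw [star_mul, mul_assoc])
    _ span_tmul_homogeneous (by
      rintro _ ⟨i, a, b, rfl⟩
      set a' := α.proj i a with ha'
      have heven : α.auto (star a' * a') = star a' * a' :=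
        α.auto_star_mul_self (α.auto_proj i a)
      -- Squaring the left leg inside `A₊` keeps it even, so the squares of `p n Ⓕ s n` are taken
      -- leg by leg without signs.
      obtain ⟨p, hp₀, hp, hpn⟩ := exists_squares (⟨star a' * a', heven⟩ : α.evenPart)
      obtain ⟨s, hs₀, hs, hsn⟩ := exists_squares (star b * b)
      refine ⟨fun n => tmul α β (p n : A) (s n), ‖star a' * a'‖ * ‖star b * b‖, ?_, fun n => ?_,
        by positivity, fun x => ?_⟩
      · beta_reduce
        rw [star_tmul_mul_self heven, hp₀, hs₀]
      · beta_reduce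
        rw [tmul_mul_coe, hp, hs]
        rfl
      obtain ⟨C, h0, hC⟩ := ((hf.comp_mulLeft (star x)).comp_mulRight x).exists_nonneg
      refine ⟨C, fun n => (hC (p n : A) (s n)).trans ?_⟩
      rw [mul_pow]
      gcongr
      · exact hpn n
      · exact hsn n)
  exact ⟨H, _, _, _, ι, π, h1, h2⟩

lemma norm_rep_tmul_le_mul {H : Type*} [NormedAddCommGroup H] [InnerProductSpace ℂ H]
    [CompleteSpace H] (π : α.evenPart ⊗[ℂ] B →⋆ₙₐ[ℂ] (H →L[ℂ] H)) (a : α.evenPart) (b : B) :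
    ‖π (a ⊗ₜ b)‖ ≤ ‖a‖ * ‖b‖ :=
  norm_bilin_le ((TensorProduct.mk ℂ α.evenPart B).compr₂
      (π : α.evenPart ⊗[ℂ] B →ₗ[ℂ] (H →L[ℂ] H)))
    (fun a a' b b' => by
      change π _ * π _ = π _
      rw [← map_mul, TensorProduct.mk_apply, TensorProduct.mk_apply, TensorProduct.mk_apply,
        Algebra.TensorProduct.tmul_mul_tmul])
    (fun a b => by
      change star (π _) = π _
      rw [← map_star, TensorProduct.mk_apply, TensorProduct.mk_apply,
        TensorProduct.star_tmul]) a b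

lemma maxNorm_incl_le (c : α.evenPart ⊗[ℂ] B) : maxNorm (incl α β c) ≤ maxNorm c :=
  maxNorm_le fun _ _ _ _ π => le_maxNorm c (π.comp (incl α β))

/-- The maximal norm of `A₊ ⊙ B` is the restriction of the maximal norm of the Fermi product. -/
theorem maxNorm_incl (c : α.evenPart ⊗[ℂ] B) : maxNorm (incl α β c) = maxNorm c := by
  refine le_antisymm (maxNorm_incl_le c) (maxNorm_le fun H _ _ _ π => ?_)
  -- The bound is proved only on vectors `π s h`, because the GNS space built from `h` sees `h` only
  -- through its orbit. This suffices when `s = c⋆`.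
  have key : ∀ h s, ‖π c (π s h)‖ ≤ maxNorm (incl α β c) * ‖π s h‖ := by
    intro h s
    let f : FermiTensor α β →ₗ[ℂ] ℂ := ((innerSL ℂ h : H →L[ℂ] ℂ) : H →ₗ[ℂ] ℂ) ∘ₗ
      (LinearMap.applyₗ h) ∘ₗ (ContinuousLinearMap.coeLM ℂ) ∘ₗ
      (π : α.evenPart ⊗[ℂ] B →ₗ[ℂ] (H →L[ℂ] H)) ∘ₗ evenMap α β
    have hf : ∀ x, f x = ⟪h, π (evenMap α β x) h⟫_ℂ := fun _ => rfl
    have hsq : ∀ y, ⟪h, π (star y * y) h⟫_ℂ = ((‖π y h‖ ^ 2 : ℝ) : ℂ) := fun y => by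
      rw [map_mul, map_star, ContinuousLinearMap.star_eq_adjoint, mul_apply_eq_comp,
        ContinuousLinearMap.adjoint_inner_right, inner_self_eq_norm_sq_to_K]
      simp
    obtain ⟨H', _, _, _, ι, ρ, hin, hρ⟩ := exists_gns_rep f
      ⟨‖h‖ * ‖h‖, fun a b => by
        rw [hf, evenMap_tmul]
        calc _ ≤ ‖h‖ * ‖π (α.evenExpectation a ⊗ₜ b) h‖ := norm_inner_le_norm _ _
          _ ≤ ‖h‖ * ((‖a‖ * ‖b‖) * ‖h‖) := by
            gcongr
            refine (π _).le_of_opNorm_le ((norm_rep_tmul_le_mul π _ b).trans ?_) h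
            gcongr
            exact α.norm_evenExpectation_le a
          _ = _ := by ring⟩
      (fun x => by
        rw [hf, hf, evenMap_star, map_star, ContinuousLinearMap.star_eq_adjoint,
          ContinuousLinearMap.adjoint_inner_right, ← inner_conj_symm]
        rfl)
      (fun x => by
        obtain ⟨n, y, hy⟩ := exists_evenMap_star_mul_self x
        rw [hf, hy, map_sum, sum_apply, inner_sum, Complex.re_sum]
        refine Finset.sum_nonneg fun m _ => ?_
        rw [hsq, Complex.ofReal_re]
        positivity)
    -- Since `ε ⊗ id` is the identity on `A₊ ⊙ B`, the orbit of `h` under `π` embeds isometrically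
    -- into the new space, intertwining `π` with `ρ ∘ incl`.
    have hnorm : ∀ y, ‖ι (incl α β y)‖ = ‖π y h‖ := fun y => by
      have h1 : ((‖ι (incl α β y)‖ ^ 2 : ℝ) : ℂ) = ((‖π y h‖ ^ 2 : ℝ) : ℂ) := by
        rw [← hsq, ← evenMap_incl (β := β) (star y * y), ← hf, map_mul, map_star, ← hin,
          inner_self_eq_norm_sq_to_K]
        simp
      rw [Complex.ofReal_inj] at h1
      exact (sq_eq_sq₀ (norm_nonneg _) (norm_nonneg _)).mp h1
    have h2 : π c (π s h) = π (c * s) h := by rw [map_mul]; rfl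
    rw [h2, ← hnorm, ← hnorm, map_mul, ← hρ]
    exact (ρ _).le_of_opNorm_le (le_maxNorm _ ρ) _
  have h0 := maxNorm_nonneg (incl α β c)
  -- Taking `s = c⋆` and using `‖π c (π c)⋆‖ = ‖π c‖²` replaces a reduction to nondegenerate
  -- representations: one factor `‖π c‖` cancels.
  have h1 : ‖π c * star (π c)‖ ≤ maxNorm (incl α β c) * ‖π c‖ := by
    refine ContinuousLinearMap.opNorm_le_bound _ (by positivity) fun h => ?_
    rw [← map_star, mul_apply_eq_comp, mul_assoc]
    refine (key h (star c)).trans (mul_le_mul_of_nonneg_left ?_ h0)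
    refine ContinuousLinearMap.le_of_opNorm_le _ ?_ h
    rw [map_star, norm_star]
  rw [CStarRing.norm_self_mul_star] at h1
  rcases (norm_nonneg (π c)).eq_or_lt with h | h
  · rw [← h]; exact h0
  · exact le_of_mul_le_mul_right h1 h

end FermiTensor

end FermiRepresentations

/-! ### Product functionals -/

section ProductFunctional

open Filter Topology

variable {D : Type u} {B : Type v} [NonUnitalCStarAlgebra D] [NonUnitalCStarAlgebra B]

/-- The functional `a ⊗ b ↦ f(a) g(b)` on the algebraic tensor product. -/
def productFunctional (f : D →L[ℂ] ℂ) (g : B →L[ℂ] ℂ) : D ⊗[ℂ] B →ₗ[ℂ] ℂ :=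
  LinearMap.mul' ℂ ℂ ∘ₗ TensorProduct.map (f : D →ₗ[ℂ] ℂ) (g : B →ₗ[ℂ] ℂ)

lemma productFunctional_tmul (f : D →L[ℂ] ℂ) (g : B →L[ℂ] ℂ) (a : D) (b : B) :
    productFunctional f g (a ⊗ₜ b) = f a * g b := rfl

lemma IsState.norm_apply_le {f : D →L[ℂ] ℂ} (hf : IsState f) (x : D) : ‖f x‖ ≤ ‖x‖ := by
  simpa [hf.2] using f.le_opNorm x

lemma IsState.gram_posSemidef {f : D →L[ℂ] ℂ} (hf : IsState f) {n : ℕ} (a : Fin n → D) :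
    (Matrix.of fun i j => f (star (a i) * a j)).PosSemidef := by
  refine Matrix.PosSemidef.of_dotProduct_mulVec_nonneg ?_ fun x => ?_
  · ext i j
    simp [Matrix.conjTranspose_apply, ← hf.apply_star]
  · have : star x ⬝ᵥ (Matrix.of fun i j => f (star (a i) * a j)).mulVec x =
        f (star (∑ i, x i • a i) * ∑ i, x i • a i) := by
      rw [star_sum, Finset.sum_mul_sum]
      simp only [dotProduct, Matrix.mulVec, Matrix.of_apply, map_sum, star_smul, smul_mul_smul_comm, map_smul, smul_eq_mul, Finset.mul_sum, Pi.star_apply]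
      exact Finset.sum_congr rfl fun i _ => Finset.sum_congr rfl fun j _ => by ring
    rw [this]
    exact hf.1 _

lemma productFunctional_star {f : D →L[ℂ] ℂ} {g : B →L[ℂ] ℂ} (hf : IsState f) (hg : IsState g)
    (y : D ⊗[ℂ] B) : productFunctional f g (star y) = star (productFunctional f g y) := by
  induction y using TensorProduct.induction_on with
  | zero => simp
  | add x y hx hy => simp only [map_add, star_add, hx, hy]
  | tmul a b =>
    rw [TensorProduct.star_tmul, productFunctional_tmul, productFunctional_tmul, hf.apply_star,
      hg.apply_star, star_mul']

/-- Schur product theorem: for `y = ∑ a_i ⊗ b_i` the value is the sum of all entries of the Hadamard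
product of the Gram matrices of `f` and `g`. -/
lemma productFunctional_star_mul_self_nonneg {f : D →L[ℂ] ℂ} {g : B →L[ℂ] ℂ} (hf : IsState f)
    (hg : IsState g) (y : D ⊗[ℂ] B) : 0 ≤ productFunctional f g (star y * y) := by
  obtain ⟨n, a, b, rfl⟩ := TensorProduct.exists_sum_tmul_eq y
  have h := ((hf.gram_posSemidef a).hadamard (hg.gram_posSemidef b)).dotProduct_mulVec_nonneg 1
  convert h using 1
  simp [dotProduct, Matrix.mulVec, star_sum, Finset.sum_mul_sum, TensorProduct.star_tmul,
    Algebra.TensorProduct.tmul_mul_tmul, productFunctional_tmul, Matrix.hadamard_apply]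

end ProductFunctional

/-! ### Contractivity of product functionals for the maximal norm -/

section ProductBound

open Filter Topology FermiTensor

variable {A : Type u} {B : Type v} [NonUnitalCStarAlgebra A] [NonUnitalCStarAlgebra B]
  {α : Z2Grading A}

/-- The restriction of a functional to the even part. -/
def evenRestrict (α : Z2Grading A) (ω : A →L[ℂ] ℂ) : α.evenPart →L[ℂ] ℂ :=
  ω ∘L ⟨(NonUnitalStarSubalgebraClass.subtype α.evenPart : α.evenPart →ₗ[ℂ] A),
    continuous_subtype_val⟩

lemma evenRestrict_apply (ω : A →L[ℂ] ℂ) (a : α.evenPart) : evenRestrict α ω a = ω a := rfl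

lemma apply_evenExpectation {ω : A →L[ℂ] ℂ} (hω : ∀ a, ω (α.auto a) = ω a) (a : A) :
    ω (α.evenExpectation a) = ω a := by
  rw [α.coe_evenExpectation, Z2Grading.proj_apply]
  simp only [map_smul, map_add, hω, Units.val_one, Int.cast_one, one_smul, smul_eq_mul]
  ring

/-- No norm is lost on restriction, since `ω = ω ∘ ε` and `ε` is contractive. -/
lemma IsState.evenRestrict {ω : A →L[ℂ] ℂ} (h : IsState ω) (hω : ∀ a, ω (α.auto a) = ω a) :
    IsState (evenRestrict α ω) := by
  refine ⟨fun x => h.1 x, le_antisymm ?_ ?_⟩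
  · exact ContinuousLinearMap.opNorm_le_bound _ zero_le_one fun a => by
      rw [one_mul]
      exact h.norm_apply_le (a : A)
  · rw [← h.2]
    refine ContinuousLinearMap.opNorm_le_bound _ (norm_nonneg _) fun a => ?_
    rw [← apply_evenExpectation hω a]
    refine ((FermiProduct.evenRestrict α ω).le_opNorm (α.evenExpectation a)).trans ?_
    gcongr
    exact α.norm_evenExpectation_le a

/-- Uses `e a e - a = (e a - a) e + (a e - a)`, where eventually `e` is self-adjoint of norm at most
one. -/
lemma tendsto_star_mul_mul {D : Type*} [NonUnitalCStarAlgebra D] [PartialOrder D]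
    [StarOrderedRing D] (a : D) :
    Tendsto (fun e : D => star e * a * e) (CStarAlgebra.approximateUnit D) (𝓝 a) := by
  have happ := CStarAlgebra.increasingApproximateUnit D
  have h1 : Tendsto (fun e : D => (e * a - a) * e) (CStarAlgebra.approximateUnit D) (𝓝 0) := by
    have h0 : Tendsto (fun e : D => ‖e * a - a‖) (CStarAlgebra.approximateUnit D) (𝓝 0) := by
      have := ((happ.tendsto_mul_right a).sub_const a).norm
      rwa [sub_self, norm_zero] at this
    refine squeeze_zero_norm' (happ.eventually_norm.mono fun e he => ?_) h0
    exact (norm_mul_le _ _).trans (mul_le_of_le_one_right (norm_nonneg _) he)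
  have h2 := h1.add (happ.tendsto_mul_left a)
  rw [zero_add] at h2
  refine h2.congr' (happ.eventually_star_eq.mono fun e he => ?_)
  beta_reduce
  rw [he, sub_mul, sub_add_cancel]

/-- Product functionals of states are contractive for the maximal norm. -/
theorem norm_productFunctional_le (β : Z2Grading B) {f : α.evenPart →L[ℂ] ℂ} {g : B →L[ℂ] ℂ} (hf : IsState f)
    (hg : IsState g) (s : α.evenPart ⊗[ℂ] B) : ‖productFunctional f g s‖ ≤ maxNorm s := by
  -- The functional is moved to the Fermi product, where GNS is available; `maxNorm_incl` brings the
  -- estimate back to `A₊ ⊙ B`.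
  let F := productFunctional f g ∘ₗ evenMap α β
  have hF : ∀ x, F x = productFunctional f g (evenMap α β x) := fun _ => rfl
  obtain ⟨H, _, _, _, ι, π, hin, hπ⟩ := exists_gns_rep F
    ⟨1, fun a b => by
      rw [hF, evenMap_tmul, productFunctional_tmul, norm_mul, one_mul]
      gcongr
      · exact (hf.norm_apply_le _).trans (α.norm_evenExpectation_le a)
      · exact hg.norm_apply_le b⟩
    (fun x => by rw [hF, hF, evenMap_star, productFunctional_star hf hg])
    (fun x => by
      obtain ⟨n, y, hy⟩ := exists_evenMap_star_mul_self x
      rw [hF, hy, map_sum, Complex.re_sum]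
      exact Finset.sum_nonneg fun m _ =>
        (Complex.nonneg_iff.mp (productFunctional_star_mul_self_nonneg hf hg (y m))).1)
  let _ : PartialOrder α.evenPart := CStarAlgebra.spectralOrder _
  let _ : StarOrderedRing α.evenPart := CStarAlgebra.spectralOrderedRing _
  let _ : PartialOrder B := CStarAlgebra.spectralOrder _
  let _ : StarOrderedRing B := CStarAlgebra.spectralOrderedRing _
  have happA := CStarAlgebra.increasingApproximateUnit α.evenPart
  have happB := CStarAlgebra.increasingApproximateUnit B
  let l := CStarAlgebra.approximateUnit α.evenPart ×ˢ CStarAlgebra.approximateUnit B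
  have hin' : ∀ x y, ⟪ι (incl α β x), ι (incl α β y)⟫_ℂ = productFunctional f g (star x * y) :=
    fun x y => by rw [hin, ← map_star, ← map_mul, hF, evenMap_incl]
  -- Products of approximate units replace the missing unit vector: `F` is approximated by vector
  -- functionals of `ι (incl (e₁ ⊗ e₂))`, whose norm is eventually at most one.
  have hlim : Tendsto (fun e : α.evenPart × B =>
      productFunctional f g (star (e.1 ⊗ₜ e.2) * (s * (e.1 ⊗ₜ e.2)))) l
      (𝓝 (productFunctional f g s)) := by
    induction s using TensorProduct.induction_on with
    | zero => simp
    | add x y hx hy => simpa only [add_mul, mul_add, map_add] using hx.add hy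
    | tmul a b =>
      simp only [TensorProduct.star_tmul, Algebra.TensorProduct.tmul_mul_tmul,
        productFunctional_tmul, ← mul_assoc]
      exact ((f.continuous.tendsto a).comp ((tendsto_star_mul_mul a).comp tendsto_fst)).mul
        ((g.continuous.tendsto b).comp ((tendsto_star_mul_mul b).comp tendsto_snd))
  refine le_of_tendsto hlim.norm ?_
  filter_upwards [happA.eventually_norm.prod_mk happB.eventually_norm] with e he
  have hn : ‖ι (incl α β (e.1 ⊗ₜ e.2))‖ ≤ 1 := by
    have h1 : ‖ι (incl α β (e.1 ⊗ₜ e.2))‖ ^ 2 =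
        ‖productFunctional f g (star (e.1 ⊗ₜ e.2) * (e.1 ⊗ₜ e.2))‖ := by
      rw [← hin', inner_self_eq_norm_sq_to_K]
      simp
    rw [TensorProduct.star_tmul, Algebra.TensorProduct.tmul_mul_tmul, productFunctional_tmul,
      norm_mul] at h1
    refine le_of_sq_le_sq ?_ zero_le_one
    rw [h1, one_pow]
    refine mul_le_one₀ ((hf.norm_apply_le _).trans ?_) (norm_nonneg _)
      ((hg.norm_apply_le _).trans ?_)
    · rw [CStarRing.norm_star_mul_self]
      exact mul_le_one₀ he.1 (norm_nonneg _) he.1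
    · rw [CStarRing.norm_star_mul_self]
      exact mul_le_one₀ he.2 (norm_nonneg _) he.2
  rw [← hin', map_mul, ← hπ]
  calc _ ≤ ‖ι (incl α β (e.1 ⊗ₜ e.2))‖ * ‖π (incl α β s) (ι (incl α β (e.1 ⊗ₜ e.2)))‖ :=
        norm_inner_le_norm _ _
    _ ≤ 1 * (maxNorm (incl α β s) * 1) := by
      gcongr
      exact (π _).le_of_opNorm_le_of_le (le_maxNorm _ π) hn
    _ = maxNorm s := by rw [one_mul, mul_one, maxNorm_incl]

end ProductBound

/-! ### Maps of completions -/

section Completions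

variable {R S : Type u} [NonUnitalRing R] [StarRing R] [Module ℂ R] [FiniteRepNorms R]
  [NonUnitalRing S] [StarRing S] [Module ℂ S] [FiniteRepNorms S]

namespace MaxCompletion

lemma norm_of (c : R) : ‖of R c‖ = maxNorm c := norm_ofₗ c

lemma exists_extension {Y : Type*} [NormedAddCommGroup Y] [NormedSpace ℂ Y] [CompleteSpace Y]
    (g : R →ₗ[ℂ] Y) (hg : ∀ c, ‖g c‖ ≤ maxNorm c) :
    ∃ G : MaxCompletion R →L[ℂ] Y, (∀ c, G (of R c) = g c) ∧ ∀ x, ‖G x‖ ≤ ‖x‖ := by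
  have hg' : ∀ c, ‖g c‖ ≤ 1 * ‖(ofₗ c : MaxCompletion R)‖ := fun c => by
    rw [norm_ofₗ, one_mul]; exact hg c
  refine ⟨g.extendOfNorm ofₗ, fun c => LinearMap.extendOfNorm_eq denseRange_ofₗ ⟨1, hg'⟩ c,
    fun x => ?_⟩
  simpa using LinearMap.norm_extendOfNorm_apply_le denseRange_ofₗ 1 hg' x

/-- Contractivity is automatic: every representation of `S` composed with `T` is one of the
representations of `R` in the supremum. -/
lemma exists_map (T : R →⋆ₙₐ[ℂ] S) :
    ∃ G : MaxCompletion R →⋆ₙₐ[ℂ] MaxCompletion S, Continuous G ∧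
      ∀ c, G (of R c) = of S (T c) := by
  obtain ⟨G, hG, -⟩ := exists_extension
    ((of S : S →ₗ[ℂ] MaxCompletion S) ∘ₗ (T : R →ₗ[ℂ] S)) fun c => by
      change ‖of S (T c)‖ ≤ _
      rw [norm_of]
      exact maxNorm_le fun H _ _ _ π => le_maxNorm c (π.comp T)
  have hG' : ∀ c, G (of R c) = of S (T c) := hG
  refine ⟨{ toFun := G
            map_smul' := map_smul G
            map_zero' := map_zero G
            map_add' := map_add G
            map_mul' := fun x y => ?_
            map_star' := fun x => ?_ }, G.continuous, hG⟩
  · induction x, y using induction₂ with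
    | hp => exact isClosed_eq (by fun_prop) (by fun_prop)
    | ih c d =>
      change G (of R c * of R d) = G (of R c) * G (of R d)
      rw [← map_mul, hG', hG', hG', map_mul, map_mul]
  · induction x using induction₁ with
    | hp => exact isClosed_eq (by fun_prop) (by fun_prop)
    | ih c =>
      change G (star (of R c)) = star (G (of R c))
      rw [← map_star, hG', hG', map_star, map_star]

end MaxCompletion

/-- An injective `*`-homomorphism of C⋆-algebras reflects positivity. -/
lemma nonneg_of_map_nonneg {C D : Type*} [NonUnitalCStarAlgebra C] [PartialOrder C]
    [StarOrderedRing C] [NonUnitalCStarAlgebra D] [PartialOrder D] [StarOrderedRing D]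
    (J : C →⋆ₙₐ[ℂ] D) (hJ : Function.Injective J) {x : C} (hx : 0 ≤ J x) : 0 ≤ x := by
  have hsa : IsSelfAdjoint x := hJ (by rw [map_star, (IsSelfAdjoint.of_nonneg hx).star_eq])
  -- By uniqueness of the Jordan decomposition `J x⁻` is the negative part of `J x`, hence zero, and
  -- injectivity gives `x⁻ = 0`.
  have h := (CFC.posPart_negPart_unique (a := J x) (b := J x⁺) (c := J x⁻)
    (by rw [← map_sub, CFC.posPart_sub_negPart x hsa])
    (by rw [← map_mul, CFC.posPart_mul_negPart, map_zero])
    (map_nonneg J (CFC.posPart_nonneg x)) (map_nonneg J (CFC.negPart_nonneg x))).2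
  rw [(CFC.negPart_eq_zero_iff (J x) (IsSelfAdjoint.of_nonneg hx)).mpr hx, ← map_zero J] at h
  exact (CFC.negPart_eq_zero_iff x hsa).mp (hJ h.symm)

/-- The average over an involution with fixed-point algebra `j(D)` is a conditional expectation. -/
theorem exists_isConditionalExpectation_of_average {C D : Type*} [NonUnitalCStarAlgebra C]
    [PartialOrder C] [StarOrderedRing C] [NonUnitalCStarAlgebra D] [PartialOrder D]
    [StarOrderedRing D] (j : D →⋆ₙₐ[ℂ] C) (hj : Isometry j) (θ : C →⋆ₙₐ[ℂ] C)
    (hθ : ∀ y, θ (j y) = j y) (E : C →ₗ[ℂ] D) (hE : ∀ x, j (E x) = (1 / 2 : ℂ) • (x + θ x)) :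
    ∃ E' : C →CP D, (∀ x, E' x = E x) ∧ IsConditionalExpectation j E' := by
  let E' : C →CP D :=
    { E with
      map_cstarMatrix_nonneg' := fun k M hM => by
        -- Positivity of the amplified `E` is tested after the injective amplification of `j`, where
        -- it becomes the average of `M` and its image under the amplified `θ`.
        refine nonneg_of_map_nonneg (CStarMatrix.mapₙₐ j)
          (CStarMatrix.map_injective hj.injective) ?_
        have h : CStarMatrix.mapₙₐ j (M.map E) = (1 / 2 : ℂ) • (M + CStarMatrix.mapₙₐ θ M) :=
          CStarMatrix.ext fun i j => hE (M i j)
        change 0 ≤ CStarMatrix.mapₙₐ j (M.map E)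
        rw [h]
        exact half_smul_nonneg (add_nonneg hM (map_nonneg _ hM)) }
  have hE' : ∀ x, E' x = E x := fun _ => rfl
  refine ⟨E', hE', hj, fun y => hj.injective ?_, fun x y => hj.injective ?_,
    fun x y => hj.injective ?_⟩
  · rw [hE', hE, hθ, ← two_smul ℂ, smul_smul]
    norm_num
  · rw [hE', hE', map_mul j, hE, hE, map_mul θ, hθ, ← add_mul, smul_mul_assoc]
  · rw [hE', hE', map_mul j, hE, hE, map_mul θ, hθ, ← mul_add, mul_smul_comm]

end Completions

/-! ### The isometric inclusion, the conditional expectation and the product states -/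

section Expectation

open FermiTensor MaxCompletion

variable {A : Type u} {B : Type v} [NonUnitalCStarAlgebra A] [NonUnitalCStarAlgebra B]
  {α : Z2Grading A} {β : Z2Grading B}

lemma FermiMax.induction {p : FermiMax α β → Prop} (x : FermiMax α β) (hp : IsClosed {x | p x})
    (zero : p 0) (tmul : ∀ a b, p (fermiTmul α β a b)) (add : ∀ x y, p x → p y → p (x + y)) :
    p x := by
  induction x using induction₁ with
  | hp => exact hp
  | ih c =>
    change p (of _ c)
    induction c using FermiTensor.induction_on with
    | zero => rwa [map_zero]
    | tmul a b => exact tmul a b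
    | add x y hx hy => rw [map_add]; exact add _ _ hx hy

lemma MaxTensor.induction {D : Type u} [NonUnitalCStarAlgebra D] {p : MaxTensor D B → Prop}
    (x : MaxTensor D B) (hp : IsClosed {x | p x})
    (zero : p 0) (tmul : ∀ a b, p (maxTmul a b)) (add : ∀ x y, p x → p y → p (x + y)) :
    p x := by
  induction x using induction₁ with
  | hp => exact hp
  | ih c =>
    change p (of _ c)
    induction c using TensorProduct.induction_on with
    | zero => rwa [map_zero]
    | tmul a b => exact tmul a b
    | add x y hx hy => rw [map_add]; exact add _ _ hx hy

lemma FermiMax.map_eq_of_tmul {Y F G : Type*} [AddCommGroup Y] [TopologicalSpace Y] [T2Space Y]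
    [FunLike F (FermiMax α β) Y] [FunLike G (FermiMax α β) Y]
    [AddMonoidHomClass F (FermiMax α β) Y] [AddMonoidHomClass G (FermiMax α β) Y] {f : F} {g : G}
    (hf : Continuous f) (hg : Continuous g)
    (h : ∀ a b, f (fermiTmul α β a b) = g (fermiTmul α β a b)) (x : FermiMax α β) : f x = g x := by
  induction x using FermiMax.induction with
  | hp => exact isClosed_eq hf hg
  | zero => rw [map_zero, map_zero]
  | tmul a b => exact h a b
  | add x y hx hy => rw [map_add, map_add, hx, hy]

lemma MaxTensor.map_eq_of_tmul {D : Type u} [NonUnitalCStarAlgebra D] {Y F G : Type*}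
    [AddCommGroup Y] [TopologicalSpace Y] [T2Space Y]
    [FunLike F (MaxTensor D B) Y] [FunLike G (MaxTensor D B) Y]
    [AddMonoidHomClass F (MaxTensor D B) Y] [AddMonoidHomClass G (MaxTensor D B) Y] {f : F} {g : G}
    (hf : Continuous f) (hg : Continuous g)
    (h : ∀ a b, f (maxTmul a b) = g (maxTmul a b)) (x : MaxTensor D B) : f x = g x := by
  induction x using MaxTensor.induction with
  | hp => exact isClosed_eq hf hg
  | zero => rw [map_zero, map_zero]
  | tmul a b => exact h a b
  | add x y hx hy => rw [map_add, map_add, hx, hy]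

variable (α β)

/-- The isometric inclusion of `A₊ ⊗_max B` into `A Ⓕ_max B`. -/
theorem exists_isometric_inclusion : ∃ j : MaxTensor α.evenPart B →⋆ₙₐ[ℂ] FermiMax α β,
    Isometry j ∧ ∀ c, j (of _ c) = of _ (incl α β c) := by
  obtain ⟨j, hc, hj⟩ := exists_map (incl α β)
  refine ⟨j, AddMonoidHomClass.isometry_of_norm j fun x => ?_, hj⟩
  induction x using induction₁ with
  | hp => exact isClosed_eq hc.norm continuous_norm
  | ih c =>
    change ‖j (of _ c)‖ = ‖of _ c‖
    rw [hj, norm_of, norm_of, maxNorm_incl]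

/-- The even conditional expectation of `A Ⓕ_max B` onto `A₊ ⊗_max B`. -/
theorem exists_evenExpectation : ∃ (j : MaxTensor α.evenPart B →⋆ₙₐ[ℂ] FermiMax α β)
    (E : FermiMax α β →CP MaxTensor α.evenPart B),
    (∀ (a : α.evenPart) b, j (maxTmul a b) = fermiTmul α β (a : A) b) ∧
    IsEvenExpectation α β E ∧ IsConditionalExpectation j E ∧ ∀ x, ‖E x‖ ≤ ‖x‖ := by
  obtain ⟨j, hj, hjc⟩ := exists_isometric_inclusion α β
  obtain ⟨θ, hθ, hθc⟩ := exists_map (leftAuto α β)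
  have hθj : ∀ y, θ (j y) = j y := fun y => by
    induction y using induction₁ with
    | hp => exact isClosed_eq (hθ.comp hj.continuous) hj.continuous
    | ih c =>
      change θ (j (of _ c)) = j (of _ c)
      rw [hjc, hθc, leftAuto_incl]
  have hθn : ∀ x, ‖θ x‖ ≤ ‖x‖ := fun x => NonUnitalStarAlgHom.norm_apply_le θ x
  have hnorm : ∀ y, ‖j y‖ = ‖y‖ := fun y => by simpa using hj.norm_map_of_map_zero (map_zero j) y
  have hhalf : ∀ x, ‖(1 / 2 : ℂ) • (x + θ x)‖ ≤ ‖x‖ := fun x => by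
    rw [norm_smul]
    have h1 := norm_add_le x (θ x)
    have h2 : ‖(1 / 2 : ℂ)‖ = 1 / 2 := by norm_num
    rw [h2]
    linarith [hθn x]
  obtain ⟨E₀, hE₀, hE₀n⟩ := exists_extension
    ((of (α.evenPart ⊗[ℂ] B) : α.evenPart ⊗[ℂ] B →ₗ[ℂ] _) ∘ₗ evenMap α β) fun c => by
      change ‖of _ (evenMap α β c)‖ ≤ _
      -- The norm is computed after the isometry `j`, where the element is the average of `c` and
      -- its image under the contraction `θ`.
      rw [← hnorm, hjc, incl_evenMap, map_smul, map_add, ← hθc, ← norm_of]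
      exact hhalf _
  have hE₀c : ∀ c, E₀ (of _ c) = of _ (evenMap α β c) := hE₀
  have hjE : ∀ x, j (E₀ x) = (1 / 2 : ℂ) • (x + θ x) := fun x => by
    induction x using induction₁ with
    | hp =>
      exact isClosed_eq (hj.continuous.comp E₀.continuous)
        ((continuous_id.add hθ).const_smul (1 / 2 : ℂ))
    | ih c =>
      change j (E₀ (of _ c)) = (1 / 2 : ℂ) • (of _ c + θ (of _ c))
      rw [hE₀c, hjc, incl_evenMap, map_smul, map_add, hθc]
  obtain ⟨E, hE, hcond⟩ := exists_isConditionalExpectation_of_average j hj θ hθj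
    (E₀ : FermiMax α β →ₗ[ℂ] MaxTensor α.evenPart B) hjE
  exact ⟨j, E, fun a b => hjc _, fun a b => (hE _).trans (hE₀c _), hcond,
    fun x => (congrArg norm (hE x)).trans_le (hE₀n x)⟩

variable {α β}

lemma continuous_cp {C D : Type*} [NonUnitalCStarAlgebra C] [PartialOrder C]
    [StarOrderedRing C] [NonUnitalCStarAlgebra D] [PartialOrder D] [StarOrderedRing D]
    (E : C →CP D) : Continuous E := map_continuous E

lemma IsEvenExpectation.eq {E E' : FermiMax α β →CP MaxTensor α.evenPart B}
    (h : IsEvenExpectation α β E) (h' : IsEvenExpectation α β E') : E = E' :=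
  DFunLike.ext _ _ (FermiMax.map_eq_of_tmul (continuous_cp E) (continuous_cp E')
    fun a b => by rw [h, h'])

lemma IsEvenProductState.eq {ω : A →L[ℂ] ℂ} {φ : B →L[ℂ] ℂ}
    {ψ ψ' : MaxTensor α.evenPart B →L[ℂ] ℂ}
    (h : IsEvenProductState α ω φ ψ) (h' : IsEvenProductState α ω φ ψ') : ψ = ψ' :=
  DFunLike.ext _ _ (MaxTensor.map_eq_of_tmul ψ.continuous ψ'.continuous
    fun a b => by rw [h.2, h'.2])

lemma IsFermiProductState.eq {ω : A →L[ℂ] ℂ} {φ : B →L[ℂ] ℂ} {χ χ' : FermiMax α β →L[ℂ] ℂ}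
    (h : IsFermiProductState α β ω φ χ) (h' : IsFermiProductState α β ω φ χ') : χ = χ' :=
  DFunLike.ext _ _ (FermiMax.map_eq_of_tmul χ.continuous χ'.continuous
    fun a b => by rw [h.2, h'.2])

lemma norm_maxTmul_le (a : α.evenPart) (b : B) : ‖maxTmul a b‖ ≤ ‖a‖ * ‖b‖ := by
  rw [maxTmul, norm_of]
  exact maxNorm_le fun H _ _ _ π => norm_rep_tmul_le_mul π a b

/-- Positivity passes from the dense subalgebra to the completion because the cone of nonnegative
numbers is closed. The grading `β` enters only through the Fermi product used for the norm bound;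
the resulting state does not depend on it. -/
theorem exists_isEvenProductState (β : Z2Grading B) {ω : A →L[ℂ] ℂ} (hω : IsState ω)
    (hω_even : ∀ a, ω (α.auto a) = ω a) {φ : B →L[ℂ] ℂ} (hφ : IsState φ) :
    ∃ ψ, IsEvenProductState α ω φ ψ := by
  have hω' := hω.evenRestrict (α := α) hω_even
  obtain ⟨ψ, hψ, hψn⟩ := exists_extension (productFunctional (evenRestrict α ω) φ)
    (norm_productFunctional_le β hω' hφ)
  have htmul : ∀ (a : α.evenPart) b, ψ (maxTmul a b) = ω a * φ b := fun a b => hψ _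
  refine ⟨ψ, ⟨fun x => ?_, le_antisymm ?_ ?_⟩, htmul⟩
  · induction x using induction₁ with
    | hp =>
      have : IsClosed {z : ℂ | 0 ≤ z} := isClosed_Ici
      exact this.preimage (f := fun x => ψ (star x * x)) (by fun_prop)
    | ih c =>
      change 0 ≤ ψ (star (of _ c) * of _ c)
      rw [← map_star, ← map_mul, hψ]
      exact productFunctional_star_mul_self_nonneg hω' hφ c
  · exact ψ.opNorm_le_bound zero_le_one fun x => by rw [one_mul]; exact hψn x
  · rw [← hφ.2]
    refine φ.opNorm_le_bound (norm_nonneg _) fun b => ?_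
    -- Fixing `b`, the functional `a ↦ ψ(a ⊗ b)` on `A₊` has norm `|φ b|`, because the restriction
    -- of `ω` has norm one.
    have h1 : ‖φ b • evenRestrict α ω‖ ≤ ‖ψ‖ * ‖b‖ := by
      refine ContinuousLinearMap.opNorm_le_bound _ (by positivity) fun a => ?_
      rw [smul_apply, smul_eq_mul, mul_comm, evenRestrict_apply, ← htmul]
      calc _ ≤ ‖ψ‖ * (‖a‖ * ‖b‖) := ψ.le_of_opNorm_le_of_le le_rfl (norm_maxTmul_le a b)
        _ = _ := by ring
    rwa [norm_smul, hω'.2, mul_one] at h1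

/-- The composite `ψ ∘ E` has the right values because `ω(ε(a)) = ω(a)`. Its norm does not fall
below that of `ψ`, as it restricts to `ψ` along the isometry `j`. -/
lemma IsEvenProductState.comp {ω : A →L[ℂ] ℂ} (hω_even : ∀ a, ω (α.auto a) = ω a)
    {φ : B →L[ℂ] ℂ} {ψ : MaxTensor α.evenPart B →L[ℂ] ℂ} (hψ : IsEvenProductState α ω φ ψ)
    {E : FermiMax α β →CP MaxTensor α.evenPart B} (hE : IsEvenExpectation α β E) :
    ∃ χ, IsFermiProductState α β ω φ χ ∧ ∀ x, χ x = ψ (E x) := by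
  obtain ⟨j, E', hj, hE', hjE, hn⟩ := exists_evenExpectation α β
  obtain rfl := hE'.eq hE
  let χ : FermiMax α β →L[ℂ] ℂ :=
    ψ ∘L ⟨(E' : FermiMax α β →ₗ[ℂ] MaxTensor α.evenPart B), continuous_cp E'⟩
  have hχ : ∀ x, χ x = ψ (E' x) := fun _ => rfl
  refine ⟨χ, ⟨⟨fun x => ?_, le_antisymm ?_ ?_⟩, fun a b => ?_⟩, hχ⟩
  · rw [hχ]
    obtain ⟨y, hy⟩ := exists_eq_star_mul_self (map_nonneg E' (star_mul_self_nonneg x))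
    rw [hy]
    exact hψ.1.1 y
  · refine χ.opNorm_le_bound zero_le_one fun x => ?_
    rw [one_mul]
    exact (hψ.1.norm_apply_le _).trans (hn x)
  · rw [← hψ.1.2]
    refine ψ.opNorm_le_bound (norm_nonneg _) fun y => ?_
    have h1 := χ.le_opNorm (j y)
    rwa [hχ, hjE.projection, NonUnitalStarAlgHom.norm_map j hjE.isometry.injective] at h1
  · rw [hχ, hE', hψ.2, apply_evenExpectation hω_even]

end Expectation

/-! ### Cyclic subrepresentations -/

section Cyclic

variable {C : Type*} [NonUnitalCStarAlgebra C] {H : Type*} [NormedAddCommGroup H]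
  [InnerProductSpace ℂ H] [CompleteSpace H] (π : C →⋆ₙₐ[ℂ] (H →L[ℂ] H)) (ξ : H)

lemma apply_mem_cyclicSubspace (x : C) : π x ξ ∈ cyclicSubspace π ξ :=
  Submodule.le_topologicalClosure _ (Submodule.subset_span ⟨x, rfl⟩)

variable {ξ} in
lemma map_mem_cyclicSubspace (x : C) {h : H} (hh : h ∈ cyclicSubspace π ξ) :
    π x h ∈ cyclicSubspace π ξ := by
  have h1 : Submodule.span ℂ (Set.range fun x => π x ξ) ≤
      (Submodule.span ℂ (Set.range fun x => π x ξ)).comap (π x : H →ₗ[ℂ] H) := by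
    refine Submodule.span_le.mpr ?_
    rintro _ ⟨y, rfl⟩
    refine Submodule.subset_span ⟨x * y, ?_⟩
    simp only [map_mul]
    rfl
  exact map_mem_closure (π x).continuous hh fun y hy => h1 hy

lemma inner_apply_left (x : C) (h k : H) : ⟪π x h, k⟫_ℂ = ⟪h, π (star x) k⟫_ℂ := by
  rw [map_star, ContinuousLinearMap.star_eq_adjoint, ContinuousLinearMap.adjoint_inner_right]

/-- The projection onto a cyclic subspace commutes with the representation. -/
lemma starProjection_cyclicSubspace_comm (x : C) :
    (cyclicSubspace π ξ).starProjection * π x = π x * (cyclicSubspace π ξ).starProjection := by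
  ext h
  rw [mul_apply_eq_comp, mul_apply_eq_comp]
  refine Submodule.eq_starProjection_of_mem_of_inner_eq_zero
    (map_mem_cyclicSubspace π x (Submodule.starProjection_apply_mem _ h)) fun w hw => ?_
  rw [← map_sub, inner_apply_left]
  exact Submodule.starProjection_inner_eq_zero h _ (map_mem_cyclicSubspace π (star x) hw)

/-- A vector of a nondegenerate representation belongs to the cyclic subspace it generates. -/
lemma mem_cyclicSubspace
    (hπ : Dense (Submodule.span ℂ {h : H | ∃ x h', h = π x h'} : Set H)) :
    ξ ∈ cyclicSubspace π ξ := by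
  set P := (cyclicSubspace π ξ).starProjection
  have h0 : ∀ x, π x (ξ - P ξ) = 0 := fun x => by
    -- The component `ξ - P ξ` is annihilated by all of `π(C)`, hence orthogonal to `π(C) H`, whose
    -- span is dense.
    have h1 : π x (P ξ) = P (π x ξ) :=
      (DFunLike.congr_fun (starProjection_cyclicSubspace_comm π ξ x) ξ).symm
    rw [map_sub, h1, Submodule.starProjection_eq_self_iff.mpr (apply_mem_cyclicSubspace π ξ x),
      sub_self]
  have h2 : ξ - P ξ = 0 := by
    refine hπ.eq_zero_of_inner_left ℂ fun v hv => ?_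
    induction hv using Submodule.span_induction with
    | mem v hv =>
      obtain ⟨x, h', rfl⟩ := hv
      have := inner_apply_left π (star x) (ξ - P ξ) h'
      rw [star_star, h0, inner_zero_left] at this
      exact this.symm
    | zero => simp
    | add v w _ _ hv hw => simp only [inner_add_right, hv, hw, add_zero]
    | smul z v _ hv => simp only [inner_smul_right, hv, mul_zero]
  rw [sub_eq_zero] at h2
  exact Submodule.starProjection_eq_self_iff.mp h2.symm

/-- The restriction of a representation to a cyclic subspace is a GNS representation of the vector
functional. -/
theorem exists_cyclic_subrepresentation {χ : C →L[ℂ] ℂ} (hξ : ξ ∈ cyclicSubspace π ξ)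
    (hχ : ∀ x, χ x = ⟪ξ, π x ξ⟫_ℂ) :
    ∃ ρ : C →⋆ₙₐ[ℂ] (cyclicSubspace π ξ →L[ℂ] cyclicSubspace π ξ),
      (∀ x k, (ρ x k : H) = (cyclicSubspace π ξ).starProjection (π x k)) ∧
      IsGNS χ ρ ⟨ξ, hξ⟩ := by
  -- The subspace is invariant, so restricting `π x` gives the compression and the projection can be
  -- left out of the construction.
  let T : C → cyclicSubspace π ξ →L[ℂ] cyclicSubspace π ξ := fun x =>
    (π x ∘L (cyclicSubspace π ξ).subtypeL).codRestrict (cyclicSubspace π ξ)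
      fun k => map_mem_cyclicSubspace π x k.2
  have hT : ∀ x k, (T x k : H) = π x k := fun _ _ => rfl
  let ρ : C →⋆ₙₐ[ℂ] (cyclicSubspace π ξ →L[ℂ] cyclicSubspace π ξ) :=
    { toFun := T
      map_smul' := fun z x => by
        ext k
        simp [hT]
      map_zero' := by
        ext k
        simp [hT]
      map_add' := fun x y => by
        ext k
        simp [hT]
      map_mul' := fun x y => by
        ext k
        simp [hT]
      map_star' := fun x => by
        refine (ContinuousLinearMap.eq_adjoint_iff _ _).mpr fun h k => ?_
        rw [Submodule.coe_inner, Submodule.coe_inner, hT, hT, inner_apply_left, star_star] }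
  have hρ : ∀ x k, (ρ x k : H) = π x k := fun _ _ => rfl
  refine ⟨ρ, fun x k => ?_, ?_, fun x => hχ x⟩
  · rw [hρ, Submodule.starProjection_eq_self_iff.mpr (map_mem_cyclicSubspace π x k.2)]
  · intro k
    rw [closure_subtype, ← Set.range_comp]
    -- The orbit of `ξ` is already a linear subspace, so density of its span is density of the
    -- orbit.
    have h1 : (Submodule.span ℂ (Set.range fun x => π x ξ) : Set H) ⊆
        Set.range fun x => π x ξ := by
      refine Submodule.span_le (p := LinearMap.range ((LinearMap.applyₗ ξ) ∘ₗ
        (ContinuousLinearMap.coeLM ℂ) ∘ₗ (π : C →ₗ[ℂ] (H →L[ℂ] H)))).mpr ?_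
      rintro _ ⟨x, rfl⟩
      exact ⟨x, rfl⟩
    exact closure_mono h1 k.2

end Cyclic

/-- The amplification of a `*`-homomorphism to matrices is again a `*`-homomorphism, hence positive.
-/
lemma exists_completelyPositive_comp {C D D' : Type*} [NonUnitalCStarAlgebra C] [PartialOrder C]
    [StarOrderedRing C] [NonUnitalCStarAlgebra D] [PartialOrder D] [StarOrderedRing D]
    [NonUnitalCStarAlgebra D'] [PartialOrder D'] [StarOrderedRing D']
    (E : C →CP D) (π : D →⋆ₙₐ[ℂ] D') : ∃ Φ : C →CP D', ∀ x, Φ x = π (E x) :=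
  ⟨{ (π : D →ₗ[ℂ] D') ∘ₗ (E : C →ₗ[ℂ] D) with
      map_cstarMatrix_nonneg' := fun _ M hM =>
        map_nonneg (CStarMatrix.mapₙₐ π) (E.map_cstarMatrix_nonneg M hM) }, fun _ => rfl⟩

end FermiProduct

end

theorem mainTheorem11 {A : Type u} {B : Type v} [NonUnitalCStarAlgebra A] [NonUnitalCStarAlgebra B]
    (α : Z2Grading A) (β : Z2Grading B)
    (ω : A →L[ℂ] ℂ) (hω : IsState ω) (hω_even : ∀ a, ω (α.auto a) = ω a)
    (φ : B →L[ℂ] ℂ) (hφ : IsState φ) :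
    -- the conditional expectation and the two product states exist and are unique
    (∃! E : FermiMax α β →CP MaxTensor α.evenPart B, IsEvenExpectation α β E) ∧
    (∃! ψ : MaxTensor α.evenPart B →L[ℂ] ℂ, IsEvenProductState α ω φ ψ) ∧
    (∃! χ : FermiMax α β →L[ℂ] ℂ, IsFermiProductState α β ω φ χ) ∧
    ∀ (E : FermiMax α β →CP MaxTensor α.evenPart B) (ψ : MaxTensor α.evenPart B →L[ℂ] ℂ)
      (χ : FermiMax α β →L[ℂ] ℂ), IsEvenExpectation α β E → IsEvenProductState α ω φ ψ →
      IsFermiProductState α β ω φ χ →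
      -- `E` is a conditional expectation onto `A₊ ⊗_max B ⊆ A Ⓕ_max B`
      (∃ j : MaxTensor α.evenPart B →⋆ₙₐ[ℂ] FermiMax α β,
        (∀ (a : α.evenPart) b, j (maxTmul a b) = fermiTmul α β (a : A) b) ∧
        IsConditionalExpectation j E) ∧
      -- `ψ` has a GNS representation
      (∃ (H₀ : Type (max u v)) (_ : NormedAddCommGroup H₀) (_ : InnerProductSpace ℂ H₀)
        (_ : CompleteSpace H₀) (π₀ : MaxTensor α.evenPart B →⋆ₙₐ[ℂ] (H₀ →L[ℂ] H₀)) (ξ₀ : H₀),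
        IsGNS ψ π₀ ξ₀) ∧
      ∀ (H₀ : Type w) [NormedAddCommGroup H₀] [InnerProductSpace ℂ H₀] [CompleteSpace H₀]
        (π₀ : MaxTensor α.evenPart B →⋆ₙₐ[ℂ] (H₀ →L[ℂ] H₀)) (ξ₀ : H₀), IsGNS ψ π₀ ξ₀ →
        -- `Φ = π₀ ∘ E` is completely positive and has a minimal Stinespring dilation
        ∃ Φ : FermiMax α β →CP (H₀ →L[ℂ] H₀), (∀ x, Φ x = π₀ (E x)) ∧
          (∃ (H : Type (max u v w)) (_ : NormedAddCommGroup H) (_ : InnerProductSpace ℂ H)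
            (_ : CompleteSpace H) (π : FermiMax α β →⋆ₙₐ[ℂ] (H →L[ℂ] H)) (V : H₀ →L[ℂ] H),
            IsStinespringDilation Φ π V ∧ IsMinimalDilation π V) ∧
          -- every Stinespring dilation of `Φ` restricts to the GNS representation of `χ = ω × φ`
          ∀ (H : Type w') [NormedAddCommGroup H] [InnerProductSpace ℂ H] [CompleteSpace H]
            (π : FermiMax α β →⋆ₙₐ[ℂ] (H →L[ℂ] H)) (V : H₀ →L[ℂ] H),
            IsStinespringDilation Φ π V →
            (∀ x, (cyclicSubspace π (V ξ₀)).starProjection * π x =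
              π x * (cyclicSubspace π (V ξ₀)).starProjection) ∧
            ∃ (ρ : FermiMax α β →⋆ₙₐ[ℂ]
                (cyclicSubspace π (V ξ₀) →L[ℂ] cyclicSubspace π (V ξ₀)))
              (hV : V ξ₀ ∈ cyclicSubspace π (V ξ₀)),
              (∀ x k, (ρ x k : H) = (cyclicSubspace π (V ξ₀)).starProjection (π x k)) ∧
              IsGNS χ ρ ⟨V ξ₀, hV⟩ := by
  obtain ⟨j, E₀, hj, hE₀, hjE₀, -⟩ := exists_evenExpectation α β
  obtain ⟨ψ₀, hψ₀⟩ := exists_isEvenProductState (α := α) β hω hω_even hφ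
  obtain ⟨χ₀, hχ₀, -⟩ := hψ₀.comp hω_even hE₀
  refine ⟨⟨E₀, hE₀, fun E hE => hE.eq hE₀⟩, ⟨ψ₀, hψ₀, fun ψ hψ => hψ.eq hψ₀⟩,
    ⟨χ₀, hχ₀, fun χ hχ => hχ.eq hχ₀⟩, fun E ψ χ hE hψ hχ => ?_⟩
  obtain rfl := hE.eq hE₀
  refine ⟨⟨j, hj, hjE₀⟩, exists_isGNS hψ.1, fun H₀ _ _ _ π₀ ξ₀ hGNS => ?_⟩
  obtain ⟨Φ, hΦ⟩ := exists_completelyPositive_comp E π₀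
  refine ⟨Φ, hΦ, exists_isStinespringDilation Φ, fun H _ _ _ π V hV => ?_⟩
  -- Only nondegeneracy of the dilation is needed here, not minimality.
  have hξ := mem_cyclicSubspace π (V ξ₀) hV.nondegenerate
  obtain ⟨χ', hχ', hχψ⟩ := hψ.comp hω_even hE
  obtain rfl := hχ'.eq hχ
  -- The vector functional of `V ξ₀` is `⟨ξ₀, V⋆ π(x) V ξ₀⟩ = ⟨ξ₀, π₀(E x) ξ₀⟩ = ψ(E x)`, which is
  -- the product state.
  obtain ⟨ρ, hρ, hρG⟩ := exists_cyclic_subrepresentation (χ := χ') π (V ξ₀) hξ fun x => by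
    rw [hχψ, hGNS.apply_eq, ← hΦ, hV.apply_eq, ContinuousLinearMap.comp_apply,
      ContinuousLinearMap.adjoint_inner_right, ContinuousLinearMap.comp_apply]
  exact ⟨starProjection_cyclicSubspace_comm π (V ξ₀), ρ, hξ, hρ, hρG⟩
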